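/- Let $n\ge 2$. For $0<B\le+\infty$ and $\lambda\in\mathbb R$, consider a gradient Ricci soliton $g=dx^2+\psi(x)^2g_{\mathbb S^n}$ on $(0,B)\times\mathbb S^n$ with radial potential $\phi=\phi(x)$ ($\psi>0$ and $\phi$ smooth), i.e. $\mathrm{Ric}(g)+\nabla\nabla\phi+\lambda g=0$. With $\omega=\dot\phi$ this is the system $$n\ddot\psi-\psi\dot\omega=\lambda\psi,\qquad \psi\ddot\psi+(n-1)\dot\psi^2-(n-1)-\psi\dot\psi\,\omega=\lambda\psi^2 .$$ Put $W=\big(-\omega+n\dot\psi/\psi\big)^{-1}$, $X=\sqrt n\,W\dot\psi/\psi$, $Y=\sqrt{n(n-1)}\,W/\psi$. The soliton is called *singular* if $W,Y>0$ near $x=0$ and $(W,X,Y)\to(0,1,0)$ as $x\to0^+$. A singular soliton is called *half-complete* if $\lambda=0$, $B=+\infty$, and $X>0$, $Y>0$, $X^2+Y^2<1$ for all $x>0$. Let $\rho_t$ denote the flow (with $\rho_0=\mathrm{id}$) of the time-dependent vector field $\frac{1}{1+2\lambda t}\,\mathrm{grad}_g\phi$; it acts on the variable $x$ only, by $\partial_t\rho_t(x)=\frac{1}{1+2\lambda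 t}\,\omega(\rho_t(x))$. **(1)** For every singular soliton there are $\delta>0$ with $(0,\delta)\subseteq(0,B)$ and $T>0$ with $1+2\lambda t>0$ on $[0,T)$ such that the flow $\rho_t:(0,\delta)\to(0,B)$ exists for $t\in[0,T)$, and the following hold. - Each $\rho_t$ is a smooth, increasing diffeomorphism of $(0,\delta)$ onto its image, and the evolving metric $g(t)=(1+2\lambda t)\rho_t^*g$ solves the Ricci flow $\partial_tg(t)=-2\,\mathrm{Ric}(g(t))$ on $(0,\delta)\times\mathbb S^n$ for $t\in[0,T)$. - For all $x\in(0,\delta)$ and $t\in[0,T)$, $$x^2+(\sqrt n-1)t\le\rho_t(x)^2\le x^2+4(\sqrt n-1)t\qquad\text{if }\lambda=0,$$ $$x^2+\tfrac{\sqrt n-1}{2\lambda}\log(1+2\lambda t)\le\rho_t(x)^2\le x^2+2\,\tfrac{\sqrt n-1}{\lambda}\log(1+2\lambda t)\qquad\text{if }\lambda\ne0 .$$ - Let $m(t)=\inf\rho_t\big((0,\delta)\big)$. Then $\rho_t\big((0,\delta)\big)\subseteq(m(t),+\infty)$ for $t\in[0,T)$, $m(t)>0$ for $t\in(0,T)$,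 and $m$ is non-decreasing on $[0,T)$. In particular, for $t\in(0,T)$ the image of $\rho_t$ does not contain $(0,\delta)$, so $\rho_t$ is not surjective. **(2)** For every half-complete soliton, $\omega$ has exactly one zero $x_{\rm crit}$ in $(0,+\infty)$; moreover $\omega>0$ on $(0,x_{\rm crit})$ and $\omega<0$ on $(x_{\rm crit},+\infty)$. The flow $\rho_t:(0,+\infty)\to(0,+\infty)$ exists for all $t\ge0$, each $\rho_t$ is a smooth, increasing diffeomorphism onto its image, and $g(t)=\rho_t^*g$ solves the Ricci flow on $(0,+\infty)\times\mathbb S^n$ for all $t\ge0$. With $m(t)=\inf\rho_t\big((0,+\infty)\big)$ one has $\rho_t\big((0,+\infty)\big)=(m(t),+\infty)$ for $t\ge0$, $m(t)>0$ for $t>0$ (so $\rho_t$ is not surjective), $m$ is non-decreasing, $\rho_t(x)\to x_{\rm crit}$ as $t\to+\infty$ for every $x\in(0,+\infty)$, and $m(t)\to x_{\rm crit}$ as $t\to+\infty$. -/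

import Mathlib

open Set Filter Topology
open scoped ContDiff

namespace RadialSoliton

noncomputable section

/-- The interval `(0, B)` of radii, where `B` may be `+∞`. -/
def radii (B : EReal) : Set ℝ := {x : ℝ | 0 < x ∧ (x : EReal) < B}

theorem radii_top : radii ⊤ = Ioi 0 := by
  ext x
  simp [radii, EReal.coe_lt_top]

theorem radii_coe (b : ℝ) : radii (b : EReal) = Ioo 0 b := by
  ext x
  simp [radii]

/-! Spherically symmetric tensors on `(0, B) × 𝕊ⁿ`. The metric `χ² dx² + ψ² g_{𝕊ⁿ}` is given by the
pair of functions `χ, ψ > 0` of `x`; every symmetric tensor below has the form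
`a dx² + b g_{𝕊ⁿ}` and is given by its two coefficient functions `a` and `b`. -/

/-- The derivative `∂ₛ = χ⁻¹ ∂ₓ` with respect to arc length, `ds = χ dx`. -/
def arcDeriv (χ f : ℝ → ℝ) : ℝ → ℝ := fun x => deriv f x / χ x

/-- The `dx²` coefficient of the Ricci tensor of `χ² dx² + ψ² g_{𝕊ⁿ}`. -/
def ricciRadial (n : ℕ) (χ ψ : ℝ → ℝ) (x : ℝ) : ℝ :=
  -(n : ℝ) * (arcDeriv χ (arcDeriv χ ψ) x / ψ x) * χ x ^ 2

/-- The `g_{𝕊ⁿ}` coefficient of the Ricci tensor of `χ² dx² + ψ² g_{𝕊ⁿ}`. -/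
def ricciSphere (n : ℕ) (χ ψ : ℝ → ℝ) (x : ℝ) : ℝ :=
  ((n : ℝ) - 1) - ψ x * arcDeriv χ (arcDeriv χ ψ) x - ((n : ℝ) - 1) * arcDeriv χ ψ x ^ 2

/-- The `dx²` coefficient of the Hessian of the radial function `φ`
for the metric `χ² dx² + ψ² g_{𝕊ⁿ}`. -/
def hessRadial (χ φ : ℝ → ℝ) (x : ℝ) : ℝ :=
  arcDeriv χ (arcDeriv χ φ) x * χ x ^ 2

/-- The `g_{𝕊ⁿ}` coefficient of the Hessian of the radial function `φ`
for the metric `χ² dx² + ψ² g_{𝕊ⁿ}`. -/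
def hessSphere (χ ψ φ : ℝ → ℝ) (x : ℝ) : ℝ :=
  ψ x * arcDeriv χ ψ x * arcDeriv χ φ x

/-- `g = dx² + ψ² g_{𝕊ⁿ}` on `(0, B) × 𝕊ⁿ`, with the smooth radial potential `φ`, satisfies the
gradient Ricci soliton equation `Ric(g) + ∇∇φ + lam g = 0`. -/
structure IsGradientSoliton (n : ℕ) (lam : ℝ) (B : EReal) (ψ φ : ℝ → ℝ) : Prop where
  smooth_psi : ContDiffOn ℝ ∞ ψ (radii B)
  smooth_phi : ContDiffOn ℝ ∞ φ (radii B)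
  psi_pos : ∀ x ∈ radii B, 0 < ψ x
  radial : ∀ x ∈ radii B,
    ricciRadial n (fun _ => 1) ψ x + hessRadial (fun _ => 1) φ x + lam = 0
  sphere : ∀ x ∈ radii B,
    ricciSphere n (fun _ => 1) ψ x + hessSphere (fun _ => 1) ψ φ x + lam * ψ x ^ 2 = 0

/-- `W = 1 / (-ω + n ψ' / ψ)` with `ω = φ'`. -/
def varW (n : ℕ) (ψ φ : ℝ → ℝ) (x : ℝ) : ℝ := 1 / (-deriv φ x + n * (deriv ψ x / ψ x))

/-- `X = √n W ψ' / ψ`. -/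
def varX (n : ℕ) (ψ φ : ℝ → ℝ) (x : ℝ) : ℝ := √(n : ℝ) * varW n ψ φ x * (deriv ψ x / ψ x)

/-- `Y = √(n (n - 1)) W / ψ`. -/
def varY (n : ℕ) (ψ φ : ℝ → ℝ) (x : ℝ) : ℝ := √((n : ℝ) * ((n : ℝ) - 1)) * varW n ψ φ x / ψ x

/-- The singular solitons: those gradient solitons on `(0, B) × 𝕊ⁿ`, `0 < B ≤ +∞`, whose trajectory
`(W, X, Y)`, with `W, Y > 0`, emanates from the equilibrium point `(0, 1, 0)` as `x → 0⁺`. -/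
structure IsSingularSoliton (n : ℕ) (lam : ℝ) (B : EReal) (ψ φ : ℝ → ℝ) : Prop
    extends IsGradientSoliton n lam B ψ φ where
  B_pos : 0 < B
  positive : ∀ᶠ x in 𝓝[>] (0 : ℝ), 0 < varW n ψ φ x ∧ 0 < varY n ψ φ x
  emanates : Tendsto (fun x => (varW n ψ φ x, varX n ψ φ x, varY n ψ φ x))
    (𝓝[>] 0) (𝓝 (0, 1, 0))

/-- The half-complete steady solitons: the singular solitons with `lam = 0` that are defined on all
of `(0, +∞) × 𝕊ⁿ` and whose trajectory `(X, Y)` lies in the open first quadrant, inside the unit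
disc. -/
structure IsHalfCompleteSoliton (n : ℕ) (ψ φ : ℝ → ℝ) : Prop
    extends IsSingularSoliton n 0 ⊤ ψ φ where
  quadrant : ∀ x, 0 < x → 0 < varX n ψ φ x ∧ 0 < varY n ψ φ x
  disc : ∀ x, 0 < x → varX n ψ φ x ^ 2 + varY n ψ φ x ^ 2 < 1

/-- `ρ t x`, for times `t ∈ I` and starting points `x ∈ S`, is the flow on `(0, B)`, starting from
the identity at time `0`, of the time-dependent vector field `(1 + 2 lam t)⁻¹ grad_g φ`. For
`g = dx² + ψ² g_{𝕊ⁿ}` and radial `φ` one has `grad_g φ = φ' ∂ₓ`. -/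
structure IsRadialFlow (lam : ℝ) (B : EReal) (φ : ℝ → ℝ) (I S : Set ℝ) (ρ : ℝ → ℝ → ℝ) :
    Prop where
  init : ∀ x ∈ S, ρ 0 x = x
  mem : ∀ t ∈ I, ∀ x ∈ S, ρ t x ∈ radii B
  ode : ∀ t ∈ I, ∀ x ∈ S,
    HasDerivWithinAt (fun τ => ρ τ x) (1 / (1 + 2 * lam * t) * deriv φ (ρ t x)) I t

/-- On the set `S`, the map `f` is a smooth diffeomorphism onto its image (in dimension one:
smooth and injective with nowhere vanishing derivative), preserving the orientation. -/
def IsRadialDiffeo (S : Set ℝ) (f : ℝ → ℝ) : Prop :=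
  ContDiffOn ℝ ∞ f S ∧ StrictMonoOn f S ∧ ∀ x ∈ S, 0 < deriv f x

/-- The metrics `g(t) = χ(t)² dx² + Ψ(t)² g_{𝕊ⁿ}`, `t ∈ I`, on `S × 𝕊ⁿ` solve the Ricci flow
`∂ₜ g(t) = -2 Ric(g(t))`. -/
def IsRadialRicciFlow (n : ℕ) (I S : Set ℝ) (χ Ψ : ℝ → ℝ → ℝ) : Prop :=
  ∀ t ∈ I, ∀ x ∈ S, 0 < χ t x ∧ 0 < Ψ t x ∧
    HasDerivWithinAt (fun τ => χ τ x ^ 2) (-2 * ricciRadial n (χ t) (Ψ t) x) I t ∧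
    HasDerivWithinAt (fun τ => Ψ τ x ^ 2) (-2 * ricciSphere n (χ t) (Ψ t) x) I t

/-- The `dx` component `χ(t) = √(1 + 2 lam t) ∂ₓρ_t` of `g(t) = (1 + 2 lam t) ρ_t^* g`. -/
def evolvingChi (lam : ℝ) (ρ : ℝ → ℝ → ℝ) (t x : ℝ) : ℝ :=
  √(1 + 2 * lam * t) * deriv (ρ t) x

/-- The spherical component `Ψ(t) = √(1 + 2 lam t) ψ ∘ ρ_t` of `g(t) = (1 + 2 lam t) ρ_t^* g`. -/
def evolvingPsi (lam : ℝ) (ψ : ℝ → ℝ) (ρ : ℝ → ℝ → ℝ) (t x : ℝ) : ℝ :=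
  √(1 + 2 * lam * t) * ψ (ρ t x)

/-- `m(t)`, the infimum of the image of `S` under `ρ_t`. -/
def lowerEnd (S : Set ℝ) (ρ : ℝ → ℝ → ℝ) (t : ℝ) : ℝ := sInf (ρ t '' S)

end

end RadialSoliton

/-!
Write `ω = φ'` and `P = 1 / W = -ω + n ψ' / ψ`. The soliton equations give `P' = lam - n (ψ' / ψ)²`,
that is `W' = X² - lam W²`. At the singularity `W → 0` and `X → 1`, so `W ~ x`, and
`ω = (√n X - 1) / W` satisfies `x ω → √n - 1 > 0` (`IsSingularSoliton.tendsto_mul_deriv`).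

The flow is studied in a coordinate `u` on `(0, b)` in which the vector field `ω ∂ₓ` becomes affine
(`IsAffineCoordinate`), so that `u(ρ_t x) = α(t) u(x) + β(t)`. Such a coordinate gives at once the
existence, uniqueness and smoothness of the flow, the formula `∂ₓρ_t = α u' / u'(ρ_t)` from which
the Ricci flow equation follows (`isRadialRicciFlow_of_coordinate`), and the lower end `m(t)` of the
image, determined by `u(m(t)) = α(t) u(0) + β(t)`. What makes the flow fail to be surjective is that
`u` is finite at `0`: since `1 / ω ~ x / (√n - 1)`, the field leaves the singularity in finite time.

Near the singularity `u` is a primitive of `1 / ω`, and the growth of `ρ_t²` follows from the bounds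
on `x ω`; these bounds also keep every flow inside the domain of `u` for a short time.

For a half-complete steady soliton, `P² - n (ψ' / ψ)² - n (n - 1) / ψ²` is a constant `C`,
positive by the disc condition. If `ω` stayed positive, then `P' ≤ -C / n` would contradict `P > 0`;
and the disc condition also makes `ω' < 0` wherever `ω = 0`. Hence `ω` has
exactly one zero, which attracts and is nondegenerate, and Hadamard's lemma gives a smooth
coordinate on `(0, ∞)` linearising the field there
(`exists_linearizing_coordinate`). As `1 / ω` is bounded near the singularity and `ω` is bounded
below near `+∞`, this coordinate maps `(0, ∞)` onto a half-line `(u(0), ∞)` with `u(0) < 0`, on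
which the flow is multiplication by `exp (k t)`, where `k < 0` is the value of `ω'` at the zero.
-/

namespace RadialSoliton

/-! ### Calculus on an interval -/

theorem exists_hasDerivAt_of_continuousOn {S : Set ℝ} (hS : IsOpen S) (hc : S.OrdConnected)
    {g : ℝ → ℝ} (hg : ContinuousOn g S) {a : ℝ} (ha : a ∈ S) :
    ∃ F : ℝ → ℝ, ∀ x ∈ S, HasDerivAt F (g x) x := by
  refine ⟨fun x => ∫ s in a..x, g s, fun x hx => ?_⟩
  exact intervalIntegral.integral_hasDerivAt_right
    ((hg.mono (hc.uIcc_subset ha hx)).intervalIntegrable)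
    (hg.stronglyMeasurableAtFilter hS x hx) (hg.continuousAt (hS.mem_nhds hx))

theorem contDiffOn_infty_of_hasDerivAt {S : Set ℝ} (hS : IsOpen S) {F g : ℝ → ℝ}
    (hF : ∀ x ∈ S, HasDerivAt F (g x) x) (hg : ContDiffOn ℝ ∞ g S) : ContDiffOn ℝ ∞ F S :=
  (contDiffOn_infty_iff_deriv_of_isOpen hS).2
    ⟨fun x hx => (hF x hx).differentiableAt.differentiableWithinAt,
      hg.congr fun x hx => (hF x hx).deriv⟩

theorem contDiffOn_deriv {S : Set ℝ} (hS : IsOpen S) {f : ℝ → ℝ}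
    (hf : ContDiffOn ℝ ∞ f S) : ContDiffOn ℝ ∞ (deriv f) S :=
  ((contDiffOn_infty_iff_deriv_of_isOpen hS).1 hf).2

theorem hasDerivAt_of_contDiffOn {S : Set ℝ} (hS : IsOpen S) {f : ℝ → ℝ}
    (hf : ContDiffOn ℝ ∞ f S) {x : ℝ} (hx : x ∈ S) : HasDerivAt f (deriv f x) x :=
  ((((contDiffOn_infty_iff_deriv_of_isOpen hS).1 hf).1 x hx).differentiableAt
    (hS.mem_nhds hx)).hasDerivAt

/-- The moment `∫₀¹ sᵏ G(c + s (x - c)) ds` of `G` along the segment from `c` to `x`. These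
integrals are closed under differentiation in `x`, which makes the quotient in Hadamard's lemma
smooth. -/
noncomputable def segmentMoment (c : ℝ) (k : ℕ) (G : ℝ → ℝ) (x : ℝ) : ℝ :=
  ∫ s in (0 : ℝ)..1, s ^ k * G (c + s * (x - c))

theorem segment_mem {S : Set ℝ} (hc : S.OrdConnected) {c x s : ℝ} (hcS : c ∈ S) (hx : x ∈ S)
    (hs : s ∈ Icc (0 : ℝ) 1) : c + s * (x - c) ∈ S :=
  hc.convex.add_smul_sub_mem hcS hx hs

theorem hasDerivAt_segmentMoment {S : Set ℝ} (hS : IsOpen S) (hc : S.OrdConnected) {c : ℝ}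
    (hcS : c ∈ S) (k : ℕ) {G : ℝ → ℝ} (hG : ContDiffOn ℝ ∞ G S) {x : ℝ} (hx : x ∈ S) :
    HasDerivAt (segmentMoment c k G) (segmentMoment c (k + 1) (deriv G) x) x := by
  obtain ⟨ε, hε, hball⟩ := Metric.nhds_basis_closedBall.mem_iff.1 (hS.mem_nhds hx)
  have hcont : ∀ (j : ℕ) (H : ℝ → ℝ), ContinuousOn H S → ∀ y ∈ S,
      ContinuousOn (fun s : ℝ => s ^ j * H (c + s * (y - c))) (uIcc 0 1) := by
    intro j H hH y hy
    refine (by fun_prop : Continuous fun s : ℝ => s ^ j).continuousOn.mul (hH.comp (by fun_prop) ?_)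
    intro s hs
    rw [uIcc_of_le zero_le_one] at hs
    exact segment_mem hc hcS hy hs
  have hG' := contDiffOn_deriv hS hG
  -- The derivative of the integrand is bounded, uniformly for `y` close to `x`.
  obtain ⟨M, hM⟩ : ∃ M, ∀ q ∈ Metric.closedBall x ε ×ˢ Icc (0 : ℝ) 1,
      ‖q.2 ^ (k + 1) * deriv G (c + q.2 * (q.1 - c))‖ ≤ M := by
    refine ((isCompact_closedBall x ε).prod isCompact_Icc).exists_bound_of_continuousOn ?_
    refine (by fun_prop : Continuous fun q : ℝ × ℝ => q.2 ^ (k + 1)).continuousOn.mul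
      (hG'.continuousOn.comp (by fun_prop) ?_)
    rintro ⟨y, s⟩ ⟨hy, hs⟩
    exact segment_mem hc hcS (hball hy) hs
  refine (intervalIntegral.hasDerivAt_integral_of_dominated_loc_of_deriv_le
    (F := fun y s => s ^ k * G (c + s * (y - c)))
    (F' := fun y s => s ^ (k + 1) * deriv G (c + s * (y - c))) (bound := fun _ => M)
    (Metric.closedBall_mem_nhds x hε) ?_ ?_ ?_ ?_ ?_ ?_).2
  · filter_upwards [hS.mem_nhds hx] with y hy
    exact ((hcont k G hG.continuousOn y hy).intervalIntegrable).def'.aestronglyMeasurable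
  · exact (hcont k G hG.continuousOn x hx).intervalIntegrable
  · exact ((hcont (k + 1) _ hG'.continuousOn x hx).intervalIntegrable).def'.aestronglyMeasurable
  · refine Eventually.of_forall fun s hs y hy => hM (y, s) ⟨hy, ?_⟩
    rw [uIoc_of_le zero_le_one] at hs
    exact ⟨hs.1.le, hs.2⟩
  · exact intervalIntegrable_const
  · refine Eventually.of_forall fun s hs y hy => ?_
    rw [uIoc_of_le zero_le_one] at hs
    have h1 := hasDerivAt_of_contDiffOn hS hG (segment_mem hc hcS (hball hy) ⟨hs.1.le, hs.2⟩)
    have h2 : HasDerivAt (fun y => c + s * (y - c)) (s * 1) y :=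
      (((hasDerivAt_id y).sub_const c).const_mul s).const_add c
    convert! (h1.comp y h2).const_mul (s ^ k) using 1
    ring

theorem contDiffOn_segmentMoment {S : Set ℝ} (hS : IsOpen S) (hc : S.OrdConnected) {c : ℝ}
    (hcS : c ∈ S) (k : ℕ) {G : ℝ → ℝ} (hG : ContDiffOn ℝ ∞ G S) :
    ContDiffOn ℝ ∞ (segmentMoment c k G) S := by
  refine contDiffOn_infty.2 fun m => ?_
  induction m generalizing k G with
  | zero =>
    exact contDiffOn_zero.2 fun x hx =>
      (hasDerivAt_segmentMoment hS hc hcS k hG hx).continuousAt.continuousWithinAt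
  | succ m ih =>
    rw [Nat.cast_succ, contDiffOn_succ_iff_deriv_of_isOpen hS]
    refine ⟨fun x hx => (hasDerivAt_segmentMoment hS hc hcS k hG hx).differentiableAt
      |>.differentiableWithinAt, by simp, ?_⟩
    exact (ih (k + 1) (contDiffOn_deriv hS hG)).congr fun x hx =>
      (hasDerivAt_segmentMoment hS hc hcS k hG hx).deriv

/-- Hadamard's lemma on an interval: `f x - f c` is `x - c` times a smooth function. -/
theorem exists_contDiffOn_factor {S : Set ℝ} (hS : IsOpen S) (hc : S.OrdConnected) {c : ℝ}
    (hcS : c ∈ S) {f : ℝ → ℝ} (hf : ContDiffOn ℝ ∞ f S) :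
    ∃ a : ℝ → ℝ, ContDiffOn ℝ ∞ a S ∧ a c = deriv f c ∧ ∀ x ∈ S, f x = f c + (x - c) * a x := by
  refine ⟨segmentMoment c 0 (deriv f),
    contDiffOn_segmentMoment hS hc hcS 0 (contDiffOn_deriv hS hf), by simp [segmentMoment], ?_⟩
  intro x hx
  have hderiv : ∀ s ∈ uIcc (0 : ℝ) 1, HasDerivAt (fun s => f (c + s * (x - c)))
      (deriv f (c + s * (x - c)) * (x - c)) s := by
    intro s hs
    rw [uIcc_of_le zero_le_one] at hs
    have h1 := hasDerivAt_of_contDiffOn hS hf (segment_mem hc hcS hx hs)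
    have h2 : HasDerivAt (fun s => c + s * (x - c)) (1 * (x - c)) s :=
      ((hasDerivAt_id s).mul_const (x - c)).const_add c
    convert! h1.comp s h2 using 1
    ring
  have hint : IntervalIntegrable (fun s => deriv f (c + s * (x - c)) * (x - c))
      MeasureTheory.volume 0 1 := by
    refine ContinuousOn.intervalIntegrable (ContinuousOn.mul ?_ continuousOn_const)
    refine (contDiffOn_deriv hS hf).continuousOn.comp (by fun_prop) fun s hs => ?_
    rw [uIcc_of_le zero_le_one] at hs
    exact segment_mem hc hcS hx hs
  have := intervalIntegral.integral_eq_sub_of_hasDerivAt hderiv hint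
  rw [intervalIntegral.integral_mul_const] at this
  simp only [segmentMoment, pow_zero, one_mul]
  rw [mul_comm (x - c), this]
  simp

/-- A vector field on an interval with a single, attracting and nondegenerate zero `c` is smoothly
conjugate to a linear one: in the coordinate `u` it is `u ↦ k u` with `k = V'(c)`. Writing
`V = (x - c) a` and `a = k + (x - c) b`, one takes `u = (x - c) exp R` with `R' = -b / a`. -/
theorem exists_linearizing_coordinate {S : Set ℝ} (hS : IsOpen S) (hc : S.OrdConnected) {c : ℝ}
    (hcS : c ∈ S) {V : ℝ → ℝ} (hV : ContDiffOn ℝ ∞ V S) (hVc : V c = 0) (hk : deriv V c < 0)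
    (hleft : ∀ x ∈ S, x < c → 0 < V x) (hright : ∀ x ∈ S, c < x → V x < 0) :
    ∃ u : ℝ → ℝ, ContDiffOn ℝ ∞ u S ∧ u c = 0 ∧ (∀ x ∈ S, 0 < deriv u x) ∧
      ∀ x ∈ S, deriv u x * V x = deriv V c * u x := by
  obtain ⟨a, ha, hac, hVa⟩ := exists_contDiffOn_factor hS hc hcS hV
  obtain ⟨b, hb, -, hab⟩ := exists_contDiffOn_factor hS hc hcS ha
  rw [hVc] at hVa
  rw [hac] at hab
  simp only [zero_add] at hVa
  have ha_neg : ∀ x ∈ S, a x < 0 := by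
    intro x hx
    have h := hVa x hx
    rcases lt_trichotomy x c with hlt | rfl | hgt
    · have := hleft x hx hlt
      rw [h] at this
      nlinarith
    · rwa [hac]
    · have := hright x hx hgt
      rw [h] at this
      nlinarith
  have hr : ContDiffOn ℝ ∞ (fun x => -b x / a x) S := hb.neg.div ha fun x hx => (ha_neg x hx).ne
  obtain ⟨R, hR⟩ := exists_hasDerivAt_of_continuousOn hS hc hr.continuousOn hcS
  have hRs := contDiffOn_infty_of_hasDerivAt hS hR hr
  have hu : ∀ x ∈ S, HasDerivAt (fun x => (x - c) * Real.exp (R x))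
      (Real.exp (R x) * (deriv V c / a x)) x := by
    intro x hx
    convert! ((hasDerivAt_id x).sub_const c).mul (hR x hx).exp using 1
    have h1 := (ha_neg x hx).ne
    have h2 := hab x hx
    simp only [id]
    field_simp
    linear_combination (-1 : ℝ) * h2
  refine ⟨fun x => (x - c) * Real.exp (R x), (by fun_prop : ContDiff ℝ ∞ fun x : ℝ => x - c)
    |>.contDiffOn.mul hRs.exp, by simp, fun x hx => ?_, fun x hx => ?_⟩
  · rw [(hu x hx).deriv]
    exact mul_pos (Real.exp_pos _) (div_pos_of_neg_of_neg hk (ha_neg x hx))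
  · rw [(hu x hx).deriv, hVa x hx]
    have h1 := (ha_neg x hx).ne
    field_simp

/-- If `u ∘ f = g` near `x` with `u` smooth, injective and `u' > 0`, then `f` is as smooth as `g`. No
continuity of `f` is assumed: near `x` it is a local inverse of `u` applied to `g`. -/
theorem contDiffAt_of_comp_eq {S : Set ℝ} (hS : IsOpen S) {u : ℝ → ℝ}
    (hu : ContDiffOn ℝ ∞ u S) (hu' : ∀ x ∈ S, 0 < deriv u x) (hinj : InjOn u S)
    {f g : ℝ → ℝ} {x : ℝ} (hf : ∀ᶠ y in 𝓝 x, f y ∈ S ∧ u (f y) = g y)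
    (hg : ContDiffAt ℝ ∞ g x) : ContDiffAt ℝ ∞ f x := by
  obtain ⟨hfS, hfu⟩ := hf.self_of_nhds
  have hcd : ContDiffAt ℝ ∞ u (f x) := hu.contDiffAt (hS.mem_nhds hfS)
  have hne : (∞ : WithTop ℕ∞) ≠ 0 := by simp
  have hstrict := hcd.hasStrictFDerivAt' (f' := (ContinuousLinearEquiv.unitsEquivAut ℝ
    (Units.mk0 _ (hu' _ hfS).ne') : ℝ →L[ℝ] ℝ)) (by
      have := (hasDerivAt_of_contDiffOn hS hu hfS).hasFDerivAt
      convert! this using 1) hne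
  have hloc := hcd.to_localInverse hstrict.hasFDerivAt hne
  set L := hcd.localInverse hstrict.hasFDerivAt hne
  have hLy : L (u (f x)) = f x := hcd.localInverse_apply_image hstrict.hasFDerivAt hne
  have hLr : ∀ᶠ z in 𝓝 (u (f x)), u (L z) = z := hstrict.eventually_right_inverse
  have hLS : ∀ᶠ z in 𝓝 (u (f x)), L z ∈ S :=
    hloc.continuousAt.eventually (by rw [hLy]; exact hS.mem_nhds hfS)
  have hgt : Tendsto g (𝓝 x) (𝓝 (u (f x))) := by
    rw [hfu]; exact hg.continuousAt
  rw [hfu] at hloc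
  refine (hloc.comp x hg).congr_of_eventuallyEq ?_
  filter_upwards [hgt.eventually hLr, hgt.eventually hLS, hf] with y h1 h2 h3
  exact hinj h3.1 h2 (by rw [h3.2]; exact h1.symm)

/-- An increasing function on `(0, b)` that is bounded below has a continuous, strictly increasing
extension to `[0, b)`. -/
theorem exists_extension_zero {S : Set ℝ} (hpos : ∀ x ∈ S, 0 < x)
    (hlow : ∀ x ∈ S, ∀ y, 0 < y → y ≤ x → y ∈ S) (hne : S.Nonempty) {u : ℝ → ℝ}
    (hS : IsOpen S) (hu : ContinuousOn u S) (hmono : StrictMonoOn u S) (hbdd : BddBelow (u '' S)) :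
    ∃ w : ℝ → ℝ, (∀ x ∈ S, w x = u x) ∧ StrictMonoOn w (insert 0 S) ∧
      ContinuousOn w (insert 0 S) := by
  have h0 : (0 : ℝ) ∉ S := fun h => lt_irrefl _ (hpos 0 h)
  have hlt : ∀ x ∈ S, sInf (u '' S) < u x := by
    intro x hx
    have hx2 := hlow x hx (x / 2) (half_pos (hpos x hx)) (by linarith [hpos x hx])
    exact (csInf_le hbdd (mem_image_of_mem u hx2)).trans_lt
      (hmono hx2 hx (by linarith [hpos x hx]))
  have hw : ∀ x ∈ S, Function.update u 0 (sInf (u '' S)) x = u x := fun x hx =>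
    Function.update_of_ne (hpos x hx).ne' _ _
  refine ⟨Function.update u 0 (sInf (u '' S)), hw, ?_, ?_⟩
  · rintro x (rfl | hx) y (rfl | hy) hxy
    · exact absurd hxy (lt_irrefl _)
    · rw [hw y hy, Function.update_self]; exact hlt y hy
    · exact absurd hxy (hpos x hx).le.not_gt
    · rw [hw x hx, hw y hy]; exact hmono hx hy hxy
  · rintro x (rfl | hx)
    · rw [continuousWithinAt_insert_self, ContinuousWithinAt, Function.update_self]
      refine Tendsto.congr' (f₁ := u)
        (eventually_nhdsWithin_of_forall fun x hx => (hw x hx).symm) ?_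
      refine tendsto_order.2 ⟨fun a ha => eventually_nhdsWithin_of_forall fun x hx =>
        ha.trans (hlt x hx), fun a ha => ?_⟩
      obtain ⟨-, ⟨y, hy, rfl⟩, hya⟩ := exists_lt_of_csInf_lt (hne.image u) ha
      filter_upwards [self_mem_nhdsWithin, mem_nhdsWithin_of_mem_nhds (Iio_mem_nhds (hpos y hy))]
        with x hx hxy
      exact (hmono hx hy hxy).trans hya
    · have hSx : S ∈ 𝓝 x := hS.mem_nhds hx
      refine ContinuousAt.continuousWithinAt ((hu.continuousAt hSx).congr ?_)
      filter_upwards [hSx] with y hy using (hw y hy).symm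

/-! ### Flows that are affine in a coordinate -/

/-- A smooth increasing coordinate `u` on the interval `S = (0, b)`, extended continuously to the
endpoint `0`, in which the vector field `V` becomes the affine field `u ↦ κ u + μ`. -/
structure IsAffineCoordinate (S : Set ℝ) (V u : ℝ → ℝ) (κ μ : ℝ) : Prop where
  isOpen : IsOpen S
  ordConnected : S.OrdConnected
  pos : ∀ x ∈ S, 0 < x
  below : ∀ x ∈ S, ∀ y, 0 < y → y ≤ x → y ∈ S
  smooth : ContDiffOn ℝ ∞ u S
  deriv_pos : ∀ x ∈ S, 0 < deriv u x
  strictMono : StrictMonoOn u (insert 0 S)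
  cont : ContinuousOn u (insert 0 S)
  conj : ∀ x ∈ S, deriv u x * V x = κ * u x + μ

namespace IsAffineCoordinate

variable {S : Set ℝ} {V u : ℝ → ℝ} {κ μ : ℝ}

/-- A coordinate on the open interval that is bounded below extends to the endpoint `0`. -/
theorem of_bddBelow (hS : IsOpen S) (hc : S.OrdConnected) (hpos : ∀ x ∈ S, 0 < x)
    (hlow : ∀ x ∈ S, ∀ y, 0 < y → y ≤ x → y ∈ S) (hne : S.Nonempty)
    (hu : ContDiffOn ℝ ∞ u S) (hu' : ∀ x ∈ S, 0 < deriv u x) (hbdd : BddBelow (u '' S))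
    (hconj : ∀ x ∈ S, deriv u x * V x = κ * u x + μ) :
    ∃ w, (∀ x ∈ S, w x = u x) ∧ IsAffineCoordinate S V w κ μ := by
  have hmono : StrictMonoOn u S := strictMonoOn_of_deriv_pos hc.convex hu.continuousOn
    (by rw [hS.interior_eq]; exact hu')
  obtain ⟨w, hw, hwm, hwc⟩ := exists_extension_zero hpos hlow hne hS hu.continuousOn hmono hbdd
  have hd : ∀ x ∈ S, deriv w x = deriv u x := fun x hx =>
    Filter.EventuallyEq.deriv_eq (by filter_upwards [hS.mem_nhds hx] with y hy using hw y hy)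
  exact ⟨w, hw, hS, hc, hpos, hlow, hu.congr hw, fun x hx => by rw [hd x hx]; exact hu' x hx,
    hwm, hwc, fun x hx => by rw [hd x hx, hw x hx]; exact hconj x hx⟩

variable (h : IsAffineCoordinate S V u κ μ)
include h

theorem injOn : InjOn u S := (h.strictMono.mono (subset_insert _ _)).injOn

theorem hasDerivAt {x : ℝ} (hx : x ∈ S) : HasDerivAt u (deriv u x) x :=
  hasDerivAt_of_contDiffOn h.isOpen h.smooth hx

theorem hasDerivAt_deriv {x : ℝ} (hx : x ∈ S) : HasDerivAt (deriv u) (deriv (deriv u) x) x :=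
  hasDerivAt_of_contDiffOn h.isOpen (contDiffOn_deriv h.isOpen h.smooth) hx

theorem lt_iff_lt {x y : ℝ} (hx : x ∈ insert 0 S) (hy : y ∈ insert 0 S) :
    u x < u y ↔ x < y := h.strictMono.lt_iff_lt hx hy

theorem ordConnected_insert : (insert 0 S).OrdConnected := by
  refine ⟨?_⟩
  rintro x hx y (rfl | hy) z ⟨hxz, hzy⟩
  · rcases hx with rfl | hx
    · exact Or.inl (le_antisymm hzy hxz)
    · exact absurd (hxz.trans hzy) (h.pos x hx).not_ge
  · have hx0 : 0 ≤ x := by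
      rcases hx with rfl | hx
      · exact le_rfl
      · exact (h.pos x hx).le
    rcases (hx0.trans hxz).eq_or_lt with hz | hz
    · exact Or.inl hz.symm
    · exact Or.inr (h.below y hy z hz hzy)

theorem exists_eq {x : ℝ} (hx : x ∈ insert 0 S) {z : ℝ} (h0 : u 0 ≤ z) (hz : z ≤ u x) :
    ∃ y ∈ insert 0 S, u y = z := by
  have h0S : (0 : ℝ) ∈ insert 0 S := mem_insert _ _
  exact h.ordConnected_insert.isPreconnected.intermediate_value h0S hx h.cont ⟨h0, hz⟩

/-- The linearised equation of the coordinate: `u'' V + u' V' = κ u'`. -/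
theorem deriv_conj {x : ℝ} (hx : x ∈ S) (hV : DifferentiableAt ℝ V x) :
    deriv (deriv u) x * V x + deriv u x * deriv V x = κ * deriv u x := by
  have h1 := (h.hasDerivAt_deriv hx).mul hV.hasDerivAt
  have h2 := ((h.hasDerivAt hx).const_mul κ).add_const μ
  refine h1.unique (h2.congr_of_eventuallyEq ?_)
  filter_upwards [h.isOpen.mem_nhds hx] with y hy using h.conj y hy

theorem contDiffAt_of_comp_eq {f g : ℝ → ℝ} {x : ℝ}
    (hf : ∀ᶠ y in 𝓝 x, f y ∈ S ∧ u (f y) = g y) (hg : ContDiffAt ℝ ∞ g x) :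
    ContDiffAt ℝ ∞ f x :=
  RadialSoliton.contDiffAt_of_comp_eq h.isOpen h.smooth h.deriv_pos h.injOn hf hg

theorem hasDerivAt_of_comp_eq {f g : ℝ → ℝ} {x : ℝ}
    (hf : ∀ᶠ y in 𝓝 x, f y ∈ S ∧ u (f y) = g y) (hg : ContDiffAt ℝ ∞ g x) :
    HasDerivAt f (deriv g x / deriv u (f x)) x := by
  have hd := ((h.contDiffAt_of_comp_eq hf hg).differentiableAt (by simp)).hasDerivAt
  have hfS := hf.self_of_nhds.1
  have h1 := (h.hasDerivAt hfS).comp x hd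
  have h2 := (hg.differentiableAt (by simp)).hasDerivAt
  have h3 := h1.unique (h2.congr_of_eventuallyEq (hf.mono fun y hy => hy.2))
  convert! hd using 1
  rw [div_eq_iff (h.deriv_pos _ hfS).ne', ← h3, mul_comm]

theorem hasDerivAt_invFunOn {x : ℝ} (hx : x ∈ S) :
    HasDerivAt (Function.invFunOn u S) (1 / deriv u x) (u x) := by
  have hmap : map u (𝓝 x) = 𝓝 (u x) :=
    ((h.smooth.contDiffAt (h.isOpen.mem_nhds hx)).hasStrictDerivAt' (h.hasDerivAt hx)
      (by simp)).map_nhds_eq (h.deriv_pos x hx).ne'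
  have hev : ∀ᶠ z in 𝓝 (u x), Function.invFunOn u S z ∈ S ∧ u (Function.invFunOn u S z) = id z := by
    rw [← hmap]
    filter_upwards [image_mem_map (h.isOpen.mem_nhds hx)] with z hz
    exact ⟨Function.invFunOn_mem hz, Function.invFunOn_eq hz⟩
  have := h.hasDerivAt_of_comp_eq hev contDiffAt_id
  rwa [h.injOn.leftInvOn_invFunOn hx, deriv_id] at this

variable {S' : Set ℝ} {f : ℝ → ℝ} {α β : ℝ}

theorem contDiffAt_affine {x : ℝ} (hx : x ∈ S) : ContDiffAt ℝ ∞ (fun x => α * u x + β) x :=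
  (contDiffAt_const.mul (h.smooth.contDiffAt (h.isOpen.mem_nhds hx))).add contDiffAt_const

variable (hS' : IsOpen S') (hsub : S' ⊆ S) (hf : ∀ x ∈ S', f x ∈ S ∧ u (f x) = α * u x + β)

include hS' hsub hf in
theorem hasDerivAt_of_semiconj {x : ℝ} (hx : x ∈ S') :
    HasDerivAt f (α * deriv u x / deriv u (f x)) x := by
  have := h.hasDerivAt_of_comp_eq (by filter_upwards [hS'.mem_nhds hx] with y hy using hf y hy)
    (h.contDiffAt_affine (hsub hx))
  rwa [(((h.hasDerivAt (hsub hx)).const_mul α).add_const β).deriv] at this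

include hS' hsub hf in
theorem isRadialDiffeo_of_semiconj (hα : 0 < α) : IsRadialDiffeo S' f := by
  refine ⟨fun x hx => (h.contDiffAt_of_comp_eq
    (by filter_upwards [hS'.mem_nhds hx] with y hy using hf y hy)
    (h.contDiffAt_affine (hsub hx))).contDiffWithinAt, fun x hx y hy hxy => ?_, fun x hx => ?_⟩
  · rw [← h.lt_iff_lt (Or.inr (hf x hx).1) (Or.inr (hf y hy).1), (hf x hx).2, (hf y hy).2]
    have := (h.lt_iff_lt (Or.inr (hsub hx)) (Or.inr (hsub hy))).2 hxy
    gcongr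
  · rw [(h.hasDerivAt_of_semiconj hS' hsub hf hx).deriv]
    exact div_pos (mul_pos hα (h.deriv_pos x (hsub hx))) (h.deriv_pos _ (hf x hx).1)

variable (hlow' : ∀ x ∈ S', ∀ y, 0 < y → y ≤ x → y ∈ S') (hne : S'.Nonempty) (hα : 0 < α)
  (h0 : u 0 ≤ α * u 0 + β)

include hsub hf hα in
theorem lt_of_semiconj {m x : ℝ} (hmS : m ∈ insert 0 S) (hm : u m = α * u 0 + β) (hx : x ∈ S') :
    m < f x := by
  rw [← h.lt_iff_lt hmS (Or.inr (hf x hx).1), hm, (hf x hx).2]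
  have := (h.lt_iff_lt (mem_insert _ _) (Or.inr (hsub hx))).2 (h.pos x (hsub hx))
  gcongr

include hsub hf hlow' hα in
/-- The image of an interval `(0, δ)` is an interval starting at the point `m` to which the affine
extension of the map sends the endpoint `0`. -/
theorem mem_image_of_semiconj {m x y : ℝ} (hmS : m ∈ insert 0 S) (hm : u m = α * u 0 + β)
    (hx : x ∈ S') (hmy : m < y) (hyx : y ≤ f x) : y ∈ f '' S' := by
  have hm0 : 0 ≤ m := by
    rcases hmS with rfl | hmS
    · exact le_rfl
    · exact (h.pos m hmS).le
  have hyS : y ∈ S := h.below _ (hf x hx).1 y (hm0.trans_lt hmy) hyx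
  have hy1 : α * u 0 + β < u y := by rw [← hm]; exact (h.lt_iff_lt hmS (Or.inr hyS)).2 hmy
  have hy2 : u y ≤ α * u x + β := by
    rw [← (hf x hx).2]
    exact h.strictMono.monotoneOn (Or.inr hyS) (Or.inr (hf x hx).1) hyx
  have hz1 : u 0 < (u y - β) / α := by rw [lt_div_iff₀ hα]; linarith
  have hz2 : (u y - β) / α ≤ u x := by rw [div_le_iff₀ hα]; linarith
  obtain ⟨w, hw, hwz⟩ := h.exists_eq (Or.inr (hsub hx)) hz1.le hz2
  have hw0 : 0 < w := by rw [← h.lt_iff_lt (mem_insert _ _) hw, hwz]; exact hz1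
  have hwx : w ≤ x := by
    rw [← h.strictMono.le_iff_le hw (Or.inr (hsub hx)), hwz]; exact hz2
  have hwS := hlow' x hx w hw0 hwx
  refine ⟨w, hwS, h.injOn (hf w hwS).1 hyS ?_⟩
  rw [(hf w hwS).2, hwz]
  field_simp
  ring

include hsub hf hlow' hα hne h0 in
theorem sInf_image_of_semiconj : sInf (f '' S') ∈ insert 0 S ∧ u (sInf (f '' S')) = α * u 0 + β := by
  obtain ⟨x, hx⟩ := hne
  have hlt := (h.lt_iff_lt (mem_insert _ _) (Or.inr (hsub hx))).2 (h.pos x (hsub hx))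
  obtain ⟨m, hmS, hm⟩ := h.exists_eq (Or.inr (hf x hx).1) h0 (by rw [(hf x hx).2]; gcongr)
  have hmx := h.lt_of_semiconj hsub hf hα hmS hm hx
  suffices IsGLB (f '' S') m by
    rw [this.csInf_eq ⟨_, mem_image_of_mem f hx⟩]
    exact ⟨hmS, hm⟩
  refine ⟨?_, fun b hb => le_of_forall_gt_imp_ge_of_dense fun y hy => ?_⟩
  · rintro - ⟨y, hy, rfl⟩
    exact (h.lt_of_semiconj hsub hf hα hmS hm hy).le
  · refine (hb (h.mem_image_of_semiconj hsub hf hlow' hα hmS hm hx (lt_min hy hmx)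
      (min_le_right _ _))).trans (min_le_left _ _)

include hsub hf hlow' hα hne h0 in
theorem image_subset_of_semiconj : f '' S' ⊆ Ioi (sInf (f '' S')) := by
  obtain ⟨h1, h2⟩ := h.sInf_image_of_semiconj hsub hf hlow' hne hα h0
  rintro - ⟨x, hx, rfl⟩
  exact h.lt_of_semiconj hsub hf hα h1 h2 hx

include hsub hf hlow' hα hne in
theorem sInf_pos_of_semiconj (h0' : u 0 < α * u 0 + β) : 0 < sInf (f '' S') := by
  obtain ⟨h1, h2⟩ := h.sInf_image_of_semiconj hsub hf hlow' hne hα h0'.le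
  rwa [← h.lt_iff_lt (mem_insert _ _) h1, h2]

include hsub hf hlow' hα hne in
theorem not_surjOn_of_semiconj (h0' : u 0 < α * u 0 + β) : ¬ SurjOn f S' S' := by
  have h1 := h.sInf_pos_of_semiconj hsub hf hlow' hne hα h0'
  have h2 := h.image_subset_of_semiconj hsub hf hlow' hne hα h0'.le
  obtain ⟨x, hx⟩ := hne
  intro hsurj
  have h3 := h2 (hsurj (hlow' x hx (min x (sInf (f '' S'))) (lt_min (h.pos x (hsub hx)) h1)
    (min_le_left _ _)))
  exact absurd (min_le_right x (sInf (f '' S'))) (not_le.2 h3)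

omit hne h0 in
include hsub hlow' in
theorem monotoneOn_lowerEnd_of_semiconj {I : Set ℝ} {ρ : ℝ → ℝ → ℝ} {α β : ℝ → ℝ}
    (hne : S'.Nonempty) (hα : ∀ t ∈ I, 0 < α t)
    (hρ : ∀ t ∈ I, ∀ x ∈ S', ρ t x ∈ S ∧ u (ρ t x) = α t * u x + β t)
    (h0 : ∀ t ∈ I, u 0 ≤ α t * u 0 + β t) (hmono : MonotoneOn (fun t => α t * u 0 + β t) I) :
    MonotoneOn (lowerEnd S' ρ) I := by
  intro s hs t ht hst
  obtain ⟨h1, h2⟩ := h.sInf_image_of_semiconj hsub (hρ s hs) hlow' hne (hα s hs) (h0 s hs)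
  obtain ⟨h3, h4⟩ := h.sInf_image_of_semiconj hsub (hρ t ht) hlow' hne (hα t ht) (h0 t ht)
  rw [lowerEnd, lowerEnd, ← h.strictMono.le_iff_le h1 h3, h2, h4]
  exact hmono hs ht hst

end IsAffineCoordinate

/-! ### The evolving metric -/

/-- If `χ = √c J` and `Ψ = √c (ψ ∘ f)` with `J = f'`, then `∂ₛΨ = ψ' ∘ f`: arc length is scaled by
`√c` along with `Ψ`. -/
theorem arcDeriv_pullback {ψ f : ℝ → ℝ} {c p J x : ℝ} (hc : 0 < c) (hJ : 0 < J)
    (hf : HasDerivAt f J x) (hψ : HasDerivAt ψ p (f x)) :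
    arcDeriv (fun x => √c * deriv f x) (fun x => √c * ψ (f x)) x = p := by
  have h1 : HasDerivAt (fun x => √c * ψ (f x)) (√c * (p * J)) x := (hψ.comp x hf).const_mul _
  have hc' : √c ≠ 0 := (Real.sqrt_pos.2 hc).ne'
  simp only [arcDeriv]
  rw [h1.deriv, hf.deriv]
  field_simp

theorem arcDeriv_arcDeriv_pullback {S' T : Set ℝ} (hS' : IsOpen S') (hT : IsOpen T)
    {ψ f : ℝ → ℝ} {c x : ℝ} (hc : 0 < c) (hψ : ContDiffOn ℝ ∞ ψ T)
    (hf : ∀ x ∈ S', f x ∈ T ∧ DifferentiableAt ℝ f x ∧ 0 < deriv f x) (hx : x ∈ S') :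
    arcDeriv (fun x => √c * deriv f x)
      (arcDeriv (fun x => √c * deriv f x) (fun x => √c * ψ (f x))) x =
      deriv (deriv ψ) (f x) / √c := by
  have h1 : ∀ y ∈ S', arcDeriv (fun x => √c * deriv f x) (fun x => √c * ψ (f x)) y =
      deriv ψ (f y) := fun y hy => arcDeriv_pullback hc (hf y hy).2.2 (hf y hy).2.1.hasDerivAt
    (hasDerivAt_of_contDiffOn hT hψ (hf y hy).1)
  have h2 := (hasDerivAt_of_contDiffOn hT (contDiffOn_deriv hT hψ) (hf x hx).1).comp x
    (hf x hx).2.1.hasDerivAt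
  have h3 : HasDerivAt (arcDeriv (fun x => √c * deriv f x) (fun x => √c * ψ (f x)))
      (deriv (deriv ψ) (f x) * deriv f x) x :=
    h2.congr_of_eventuallyEq (by filter_upwards [hS'.mem_nhds hx] with y hy using h1 y hy)
  have hc' : √c ≠ 0 := (Real.sqrt_pos.2 hc).ne'
  have hJ := (hf x hx).2.2.ne'
  rw [arcDeriv, h3.deriv]
  field_simp

theorem arcDeriv_one (f : ℝ → ℝ) : arcDeriv (fun _ => 1) f = deriv f := by
  ext x
  simp [arcDeriv]

theorem isOpen_radii (B : EReal) : IsOpen (radii B) :=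
  isOpen_Ioi.inter (isOpen_Iio.preimage continuous_coe_real_ereal)

theorem IsGradientSoliton.radial_ode {n : ℕ} {lam : ℝ} {B : EReal} {ψ φ : ℝ → ℝ}
    (h : IsGradientSoliton n lam B ψ φ) {x : ℝ} (hx : x ∈ radii B) :
    deriv (deriv φ) x + lam = n * (deriv (deriv ψ) x / ψ x) := by
  have := h.radial x hx
  simp only [ricciRadial, hessRadial, arcDeriv_one] at this
  linarith

theorem IsGradientSoliton.sphere_ode {n : ℕ} {lam : ℝ} {B : EReal} {ψ φ : ℝ → ℝ}
    (h : IsGradientSoliton n lam B ψ φ) {x : ℝ} (hx : x ∈ radii B) :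
    ψ x * deriv (deriv ψ) x = (n - 1) - (n - 1) * deriv ψ x ^ 2 + ψ x * deriv ψ x * deriv φ x
      + lam * ψ x ^ 2 := by
  have := h.sphere x hx
  simp only [ricciSphere, hessSphere, arcDeriv_one] at this
  linarith

/-- The family `(1 + 2 lam t) ρ_t^* g` moves by scaling and by the flow of `grad φ`, so the soliton
equation turns `∂ₜ` of it into `-2 Ric`. The coordinate `u` gives the mixed derivative
`∂ₜ ∂ₓ ρ = ω'(ρ) ∂ₓ ρ / (1 + 2 lam t)`, where `ω = φ'`. -/
theorem isRadialRicciFlow_of_coordinate {n : ℕ} {lam : ℝ} {B : EReal} {ψ φ : ℝ → ℝ}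
    (hsol : IsGradientSoliton n lam B ψ φ) {S S' I : Set ℝ} {u : ℝ → ℝ} {κ μ : ℝ}
    (h : IsAffineCoordinate S (deriv φ) u κ μ) (hSB : S ⊆ radii B) (hS' : IsOpen S')
    (hsub : S' ⊆ S) (hI : ∀ t ∈ I, 0 < 1 + 2 * lam * t) {ρ : ℝ → ℝ → ℝ}
    (hρ : IsRadialFlow lam B φ I S' ρ) {α β : ℝ → ℝ} (hαpos : ∀ t ∈ I, 0 < α t)
    (hα : ∀ t ∈ I, HasDerivWithinAt α (κ * α t / (1 + 2 * lam * t)) I t)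
    (hu : ∀ t ∈ I, ∀ x ∈ S', ρ t x ∈ S ∧ u (ρ t x) = α t * u x + β t) :
    IsRadialRicciFlow n I S' (evolvingChi lam ρ) (evolvingPsi lam ψ ρ) := by
  have hJ : ∀ t ∈ I, ∀ x ∈ S', HasDerivAt (ρ t) (α t * deriv u x / deriv u (ρ t x)) x :=
    fun t ht x hx => h.hasDerivAt_of_semiconj hS' hsub (hu t ht) hx
  have hJpos : ∀ t ∈ I, ∀ x ∈ S', 0 < deriv (ρ t) x := fun t ht =>
    (h.isRadialDiffeo_of_semiconj hS' hsub (hu t ht) (hαpos t ht)).2.2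
  intro t ht x hx
  have hc := hI t ht
  have hρS := (hu t ht x hx).1
  have hρB := hSB hρS
  have hψpos := hsol.psi_pos _ hρB
  have hψd := hasDerivAt_of_contDiffOn (isOpen_radii B) hsol.smooth_psi hρB
  have hω := hasDerivAt_of_contDiffOn (isOpen_radii B)
    (contDiffOn_deriv (isOpen_radii B) hsol.smooth_phi) hρB
  have hode := hρ.ode t ht x hx
  have hctime : HasDerivWithinAt (fun τ => 1 + 2 * lam * τ) (2 * lam) I t := by
    simpa using (((hasDerivAt_id t).const_mul (2 * lam)).const_add 1).hasDerivWithinAt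
  have hf : ∀ y ∈ S', ρ t y ∈ radii B ∧ DifferentiableAt ℝ (ρ t) y ∧ 0 < deriv (ρ t) y :=
    fun y hy => ⟨hSB (hu t ht y hy).1, (hJ t ht y hy).differentiableAt, hJpos t ht y hy⟩
  have hA1 : arcDeriv (evolvingChi lam ρ t) (evolvingPsi lam ψ ρ t) x = deriv ψ (ρ t x) :=
    arcDeriv_pullback hc (hJpos t ht x hx) (hJ t ht x hx).differentiableAt.hasDerivAt hψd
  have hA2 : arcDeriv (evolvingChi lam ρ t) (arcDeriv (evolvingChi lam ρ t)
      (evolvingPsi lam ψ ρ t)) x = deriv (deriv ψ) (ρ t x) / √(1 + 2 * lam * t) :=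
    arcDeriv_arcDeriv_pullback hS' (isOpen_radii B) hc hsol.smooth_psi hf hx
  have hrad := hsol.radial_ode hρB
  have hsph := hsol.sphere_ode hρB
  have hs2 : √(1 + 2 * lam * t) ^ 2 = 1 + 2 * lam * t := Real.sq_sqrt hc.le
  have hs : 0 < √(1 + 2 * lam * t) := Real.sqrt_pos.2 hc
  refine ⟨mul_pos hs (hJpos t ht x hx), mul_pos hs hψpos, ?_, ?_⟩
  · have hu1 := (h.deriv_pos _ hρS).ne'
    -- The time derivative of `∂ₓρ = α u'(x) / u'(ρ)`.
    have hJt : HasDerivWithinAt (fun τ => deriv (ρ τ) x)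
        (deriv (deriv φ) (ρ t x) * deriv (ρ t) x / (1 + 2 * lam * t)) I t := by
      have h1 := ((hα t ht).mul_const (deriv u x)).div
        ((h.hasDerivAt_deriv hρS).comp_hasDerivWithinAt t hode)
        (show (deriv u ∘ fun τ => ρ τ x) t ≠ 0 from hu1)
      refine (h1.congr (fun τ hτ => (hJ τ hτ x hx).deriv) (hJ t ht x hx).deriv).congr_deriv ?_
      rw [(hJ t ht x hx).deriv]
      have h2 := h.deriv_conj hρS hω.differentiableAt
      simp only [Function.comp]
      field_simp
      linear_combination (-(α t * deriv u x)) * h2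
    have h3 := hctime.mul (hJt.pow 2)
    refine (h3.congr (fun τ hτ => ?_) ?_).congr_deriv ?_
    · simp only [evolvingChi, mul_pow, Real.sq_sqrt (hI τ hτ).le, Pi.mul_apply, Pi.pow_apply]
    · simp only [evolvingChi, mul_pow, Real.sq_sqrt (hI t ht).le, Pi.mul_apply, Pi.pow_apply]
    · rw [ricciRadial, hA2]
      simp only [evolvingChi, evolvingPsi, mul_pow, hs2, Pi.pow_apply]
      have h4 : deriv (deriv ψ) (ρ t x) / √(1 + 2 * lam * t) / (√(1 + 2 * lam * t) * ψ (ρ t x)) =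
          deriv (deriv ψ) (ρ t x) / ψ (ρ t x) / (1 + 2 * lam * t) := by
        field_simp; rw [hs2]
      rw [h4]
      have h5 : deriv (deriv φ) (ρ t x) = n * (deriv (deriv ψ) (ρ t x) / ψ (ρ t x)) - lam := by
        linarith
      rw [h5]
      field_simp
      ring
  · have h3 := hctime.mul ((hψd.comp_hasDerivWithinAt t hode).pow 2)
    refine (h3.congr (fun τ hτ => ?_) ?_).congr_deriv ?_
    · simp only [evolvingPsi, mul_pow, Real.sq_sqrt (hI τ hτ).le, Pi.mul_apply, Pi.pow_apply,
        Function.comp]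
    · simp only [evolvingPsi, mul_pow, Real.sq_sqrt (hI t ht).le, Pi.mul_apply, Pi.pow_apply,
        Function.comp]
    · rw [ricciSphere, hA2, hA1]
      simp only [evolvingPsi, Pi.pow_apply, Function.comp]
      have h4 : √(1 + 2 * lam * t) * ψ (ρ t x) * (deriv (deriv ψ) (ρ t x) / √(1 + 2 * lam * t)) =
          ψ (ρ t x) * deriv (deriv ψ) (ρ t x) := by
        field_simp
      rw [h4, hsph]
      field_simp
      ring

/-! ### Existence and uniqueness of the flow in a coordinate -/

section Flow

variable {lam : ℝ} {B : EReal} {φ : ℝ → ℝ} {S S' I : Set ℝ} {u : ℝ → ℝ} {κ μ : ℝ}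
  (h : IsAffineCoordinate S (deriv φ) u κ μ) {α β : ℝ → ℝ} (hα0 : α 0 = 1) (hβ0 : β 0 = 0)
  (hα : ∀ t ∈ I, HasDerivWithinAt α (κ * α t / (1 + 2 * lam * t)) I t)
  (hβ : ∀ t ∈ I, HasDerivWithinAt β ((κ * β t + μ) / (1 + 2 * lam * t)) I t)

include h hα0 hβ0 hα hβ

theorem exists_isRadialFlow_of_coordinate (hSB : S ⊆ radii B) (hsub : S' ⊆ S)
    (hmem : ∀ t ∈ I, ∀ x ∈ S', α t * u x + β t ∈ u '' S) :
    ∃ ρ, IsRadialFlow lam B φ I S' ρ := by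
  refine ⟨fun t x => Function.invFunOn u S (α t * u x + β t), fun x hx => ?_, fun t ht x hx =>
    hSB (Function.invFunOn_mem (hmem t ht x hx)), fun t ht x hx => ?_⟩
  · simp only [hα0, hβ0, one_mul, add_zero]
    exact h.injOn.leftInvOn_invFunOn (hsub hx)
  · obtain ⟨y, hy, hyu⟩ := hmem t ht x hx
    have h1 := h.hasDerivAt_invFunOn hy
    have h2 : HasDerivWithinAt (fun τ => α τ * u x + β τ) _ I t :=
      ((hα t ht).mul_const (u x)).add (hβ t ht)
    rw [hyu] at h1
    refine (h1.comp_hasDerivWithinAt t h2).congr_deriv ?_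
    rw [← hyu, h.injOn.leftInvOn_invFunOn hy]
    have h3 := h.conj y hy
    have h4 := (h.deriv_pos y hy).ne'
    rw [hyu] at h3
    have h5 : deriv φ y = (κ * (α t * u x + β t) + μ) / deriv u y := by
      rw [← h3]; field_simp
    rw [h5]
    ring

theorem coordinate_isRadialFlow {ρ : ℝ → ℝ → ℝ} (hρ : IsRadialFlow lam B φ I S' ρ)
    (hI : Convex ℝ I) (h0I : 0 ∈ I) (hαpos : ∀ t ∈ I, 0 < α t)
    (hmem : ∀ t ∈ I, ∀ x ∈ S', ρ t x ∈ S) {t : ℝ} (ht : t ∈ I) {x : ℝ} (hx : x ∈ S') :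
    u (ρ t x) = α t * u x + β t := by
  -- `(u(ρ) - β) / α` is constant in time.
  have hd : ∀ τ ∈ I, HasDerivWithinAt (fun τ => (u (ρ τ x) - β τ) / α τ) 0 I τ := by
    intro τ hτ
    have hρS := hmem τ hτ x hx
    have h1 : HasDerivWithinAt (fun τ => u (ρ τ x)) _ I τ :=
      (h.hasDerivAt hρS).comp_hasDerivWithinAt τ (hρ.ode τ hτ x hx)
    refine ((h1.sub (hβ τ hτ)).div (hα τ hτ) (hαpos τ hτ).ne').congr_deriv ?_
    have h3 := h.conj _ hρS
    have h4 := (hαpos τ hτ).ne'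
    simp only [Pi.sub_apply]
    rw [div_eq_zero_iff]
    left
    linear_combination α τ / (1 + 2 * lam * τ) * h3
  have := hI.norm_image_sub_le_of_norm_hasDerivWithin_le (C := 0) hd (by simp) h0I ht
  rw [zero_mul, norm_le_zero_iff, sub_eq_zero, hρ.init x hx, hα0, hβ0, sub_zero, div_one,
    div_eq_iff (hαpos t ht).ne'] at this
  linarith

end Flow

/-! ### The soliton near its singularity -/

theorem hasDerivAt_recip_varW {n : ℕ} {lam : ℝ} {B : EReal} {ψ φ : ℝ → ℝ}
    (h : IsGradientSoliton n lam B ψ φ) {x : ℝ} (hx : x ∈ radii B) :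
    HasDerivAt (fun x => -deriv φ x + n * (deriv ψ x / ψ x))
      (lam - n * (deriv ψ x / ψ x) ^ 2) x := by
  have hO := isOpen_radii B
  have h1 := hasDerivAt_of_contDiffOn hO (contDiffOn_deriv hO h.smooth_phi) hx
  have h2 := hasDerivAt_of_contDiffOn hO (contDiffOn_deriv hO h.smooth_psi) hx
  have h3 := hasDerivAt_of_contDiffOn hO h.smooth_psi hx
  have hne := (h.psi_pos x hx).ne'
  refine (h1.neg.add ((h2.div h3 hne).const_mul (n : ℝ))).congr_deriv ?_
  have h4 := h.radial_ode hx
  have h5 : deriv (deriv φ) x = n * (deriv (deriv ψ) x / ψ x) - lam := by linarith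
  rw [h5]
  field_simp
  ring

theorem radii_mem_nhdsGT {B : EReal} (hB : 0 < B) : radii B ∈ 𝓝[>] (0 : ℝ) :=
  inter_mem self_mem_nhdsWithin (mem_nhdsWithin_of_mem_nhds
    ((isOpen_Iio.preimage continuous_coe_real_ereal).mem_nhds (by simpa using hB)))

/-- `W' = X² - lam W² → 1` and `W → 0`, hence `W ~ x`; as `ω = (√n X - 1) / W`, this determines the
leading term of `ω = φ'` at the singularity. -/
theorem IsSingularSoliton.tendsto_mul_deriv {n : ℕ} {lam : ℝ} {B : EReal} {ψ φ : ℝ → ℝ}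
    (h : IsSingularSoliton n lam B ψ φ) :
    Tendsto (fun x => x * deriv φ x) (𝓝[>] 0) (𝓝 (√(n : ℝ) - 1)) := by
  have hW0 : Tendsto (varW n ψ φ) (𝓝[>] 0) (𝓝 0) := (Prod.tendsto_iff _ _).1 h.emanates |>.1
  have hXY := (Prod.tendsto_iff _ _).1 h.emanates |>.2
  have hX : Tendsto (varX n ψ φ) (𝓝[>] 0) (𝓝 1) := (Prod.tendsto_iff _ _).1 hXY |>.1
  have hrad := radii_mem_nhdsGT h.B_pos
  have hsq : √(n : ℝ) ^ 2 = n := Real.sq_sqrt n.cast_nonneg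
  have hWd : ∀ᶠ x in 𝓝[>] (0 : ℝ), HasDerivAt (varW n ψ φ)
      (varX n ψ φ x ^ 2 - lam * varW n ψ φ x ^ 2) x := by
    filter_upwards [h.positive, hrad] with x hx hxB
    have hP : -deriv φ x + n * (deriv ψ x / ψ x) ≠ 0 := (one_div_pos.1 hx.1).ne'
    have h1 := (hasDerivAt_recip_varW h.toIsGradientSoliton hxB).inv hP
    have h2 : varW n ψ φ = (fun x => -deriv φ x + n * (deriv ψ x / ψ x))⁻¹ := by
      ext y; simp [varW]
    rw [h2]
    refine h1.congr_deriv ?_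
    simp only [varX, h2, mul_pow, hsq, Pi.inv_apply]
    field_simp
    ring
  have hlim : Tendsto (fun x => varW n ψ φ x / x) (𝓝[>] 0) (𝓝 1) := by
    refine HasDerivAt.lhopital_zero_nhdsGT (g' := fun _ => 1) hWd
      (Eventually.of_forall fun x => hasDerivAt_id x) (by simp) hW0
      (tendsto_nhdsWithin_of_tendsto_nhds tendsto_id) ?_
    simpa using (hX.pow 2).sub ((hW0.pow 2).const_mul lam)
  have hlim2 := ((hX.const_mul √(n : ℝ)).sub_const 1).div hlim one_ne_zero
  rw [mul_one, div_one] at hlim2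
  refine hlim2.congr' ?_
  filter_upwards [h.positive, self_mem_nhdsWithin] with x hx hx0
  have hP : -deriv φ x + n * (deriv ψ x / ψ x) ≠ 0 := (one_div_pos.1 hx.1).ne'
  have hx0' : x ≠ 0 := ne_of_gt hx0
  have h3 : √(n : ℝ) * varX n ψ φ x = n * varW n ψ φ x * (deriv ψ x / ψ x) := by
    rw [varX, ← mul_assoc, ← mul_assoc, ← sq, hsq]
  simp only [Pi.div_apply]
  rw [h3, varW]
  generalize deriv ψ x / ψ x = q at hP ⊢
  field_simp
  ring

theorem sqrt_sub_one_pos {n : ℕ} (hn : 2 ≤ n) : 0 < √(n : ℝ) - 1 := by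
  have : (1 : ℝ) < n := by exact_mod_cast (by omega : 1 < n)
  rw [sub_pos, Real.lt_sqrt zero_le_one]
  simpa using this

/-- The bounds `√n - 1 ≤ 2 x ω ≤ 4 (√n - 1)` behind the growth estimates for `ρ²`. -/
theorem IsSingularSoliton.exists_bounds {n : ℕ} (hn : 2 ≤ n) {lam : ℝ} {B : EReal} {ψ φ : ℝ → ℝ}
    (h : IsSingularSoliton n lam B ψ φ) :
    ∃ d > 0, ∀ x ∈ Ioo 0 d, x ∈ radii B ∧ (√(n : ℝ) - 1) / 2 < x * deriv φ x ∧
      x * deriv φ x < 2 * (√(n : ℝ) - 1) := by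
  have hc := sqrt_sub_one_pos hn
  have hrad : ∀ᶠ x in 𝓝[>] (0 : ℝ), x ∈ radii B := radii_mem_nhdsGT h.B_pos
  have hev := hrad.and
    (h.tendsto_mul_deriv.eventually (Ioo_mem_nhds (by linarith : (√(n : ℝ) - 1) / 2 < √(n : ℝ) - 1)
      (by linarith : √(n : ℝ) - 1 < 2 * (√(n : ℝ) - 1))))
  obtain ⟨d, hd, hsub⟩ := mem_nhdsGT_iff_exists_Ioo_subset.1 hev
  exact ⟨d, hd, fun x hx => ⟨(hsub hx).1, (hsub hx).2.1, (hsub hx).2.2⟩⟩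

/-- `∫₀ᵗ dτ / (1 + 2 lam τ)`, the time after which the flow of `grad φ` itself agrees with the flow
of `(1 + 2 lam t)⁻¹ grad φ`. -/
noncomputable def timeChange (lam t : ℝ) : ℝ :=
  if lam = 0 then t else Real.log (1 + 2 * lam * t) / (2 * lam)

theorem timeChange_zero (lam : ℝ) : timeChange lam 0 = 0 := by
  simp [timeChange]

theorem hasDerivAt_timeChange {lam t : ℝ} (ht : 0 < 1 + 2 * lam * t) :
    HasDerivAt (timeChange lam) (1 / (1 + 2 * lam * t)) t := by
  by_cases hl : lam = 0
  · subst hl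
    have h1 : timeChange 0 = id := by ext t; simp [timeChange]
    simpa [h1] using hasDerivAt_id t
  · have h1 : HasDerivAt (fun t => 1 + 2 * lam * t) (2 * lam) t := by
      simpa using ((hasDerivAt_id t).const_mul (2 * lam)).const_add 1
    have h2 := (h1.log ht.ne').div_const (2 * lam)
    have h3 : timeChange lam = fun t => Real.log (1 + 2 * lam * t) / (2 * lam) := by
      ext t; simp [timeChange, hl]
    rw [h3]
    refine h2.congr_deriv ?_
    field_simp

theorem monotoneOn_of_hasDerivWithinAt {I : Set ℝ} (hI : Convex ℝ I) {f f' : ℝ → ℝ}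
    (hf : ∀ t ∈ I, HasDerivWithinAt f (f' t) I t) (hf' : ∀ t ∈ I, 0 ≤ f' t) : MonotoneOn f I :=
  monotoneOn_of_hasDerivWithinAt_nonneg hI (fun t ht => (hf t ht).continuousWithinAt)
    (fun t ht => (hf t (interior_subset ht)).mono interior_subset)
    fun t ht => hf' t (interior_subset ht)

theorem bddBelow_image_of_abs_deriv_le {f f' : ℝ → ℝ} {d K : ℝ} (hd : 0 < d)
    (hf : ∀ x ∈ Ioo 0 d, HasDerivAt f (f' x) x) (hK : ∀ x ∈ Ioo 0 d, |f' x| ≤ K) :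
    ∃ M, ∀ x ∈ Ioo 0 d, |f x| ≤ M := by
  have hmid : d / 2 ∈ Ioo 0 d := ⟨by linarith, by linarith⟩
  have hK0 : 0 ≤ K := (abs_nonneg _).trans (hK _ hmid)
  refine ⟨|f (d / 2)| + K * d, fun x hx => ?_⟩
  have h1 := (convex_Ioo 0 d).norm_image_sub_le_of_norm_hasDerivWithin_le
    (fun y hy => (hf y hy).hasDerivWithinAt) hK hmid hx
  rw [Real.norm_eq_abs, Real.norm_eq_abs] at h1
  have h2 : |x - d / 2| ≤ d := by
    rw [abs_le]; constructor <;> linarith [hx.1, hx.2]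
  have h3 : |f x| ≤ |f (d / 2)| + |f x - f (d / 2)| := by
    simpa using abs_add_le (f (d / 2)) (f x - f (d / 2))
  have h4 := mul_le_mul_of_nonneg_left h2 hK0
  linarith

/-- Near the singularity the field points outwards, and a primitive of `1 / ω` is a coordinate in
which it is the unit field. Since `1 / ω ~ x / (√n - 1)`, this primitive is finite at `0`: the flow
leaves the singularity in finite time. -/
theorem exists_straightening_coordinate {V : ℝ → ℝ} {c d : ℝ} (hc : 0 < c) (hd : 0 < d)
    (hV : ContDiffOn ℝ ∞ V (Ioo 0 d)) (hlow : ∀ x ∈ Ioo 0 d, c / 2 < x * V x) :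
    ∃ u, IsAffineCoordinate (Ioo 0 d) V u 0 1 := by
  have hVpos : ∀ x ∈ Ioo 0 d, 0 < V x := fun x hx =>
    pos_of_mul_pos_right ((half_pos hc).trans (hlow x hx)) hx.1.le
  have hmid : d / 2 ∈ Ioo 0 d := ⟨by linarith, by linarith⟩
  have hinv : ContDiffOn ℝ ∞ (fun x => 1 / V x) (Ioo 0 d) :=
    contDiffOn_const.div hV fun x hx => (hVpos x hx).ne'
  obtain ⟨F, hF⟩ := exists_hasDerivAt_of_continuousOn isOpen_Ioo ordConnected_Ioo
    hinv.continuousOn hmid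
  obtain ⟨M, hM⟩ := bddBelow_image_of_abs_deriv_le (K := 2 * d / c) hd hF (fun x hx => by
    have h1 := hVpos x hx
    rw [abs_of_pos (one_div_pos.2 h1), div_le_div_iff₀ h1 hc]
    nlinarith [hlow x hx, hx.2])
  obtain ⟨w, -, hw⟩ := IsAffineCoordinate.of_bddBelow (V := V) (u := F) (κ := 0) (μ := 1)
    isOpen_Ioo ordConnected_Ioo (fun x hx => hx.1)
    (fun x hx y hy hyx => ⟨hy, hyx.trans_lt hx.2⟩) ⟨_, hmid⟩
    (contDiffOn_infty_of_hasDerivAt isOpen_Ioo hF hinv)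
    (fun x hx => by rw [(hF x hx).deriv]; exact one_div_pos.2 (hVpos x hx))
    ⟨-M, by rintro - ⟨x, hx, rfl⟩; exact (abs_le.1 (hM x hx)).1⟩
    (fun x hx => by rw [(hF x hx).deriv]; field_simp [(hVpos x hx).ne']; ring)
  exact ⟨w, hw⟩

theorem singular_soliton_local_flow {n : ℕ} (hn : 2 ≤ n) {lam : ℝ} {B : EReal} {ψ φ : ℝ → ℝ}
    (hsol : IsSingularSoliton n lam B ψ φ) :
    ∃ δ > 0, ∃ T > 0, Ioo 0 δ ⊆ radii B ∧ (∀ t ∈ Ico 0 T, 0 < 1 + 2 * lam * t) ∧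
      (∃ ρ, IsRadialFlow lam B φ (Ico 0 T) (Ioo 0 δ) ρ) ∧
      ∀ ρ, IsRadialFlow lam B φ (Ico 0 T) (Ioo 0 δ) ρ →
        (∀ t ∈ Ico 0 T, IsRadialDiffeo (Ioo 0 δ) (ρ t)) ∧
        IsRadialRicciFlow n (Ico 0 T) (Ioo 0 δ) (evolvingChi lam ρ) (evolvingPsi lam ψ ρ) ∧
        (∀ t ∈ Ico 0 T, ∀ x ∈ Ioo 0 δ,
          x ^ 2 + (√(n : ℝ) - 1) * timeChange lam t ≤ ρ t x ^ 2 ∧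
          ρ t x ^ 2 ≤ x ^ 2 + 4 * (√(n : ℝ) - 1) * timeChange lam t) ∧
        (∀ t ∈ Ico 0 T, ρ t '' Ioo 0 δ ⊆ Ioi (lowerEnd (Ioo 0 δ) ρ t)) ∧
        (∀ t ∈ Ioo 0 T, 0 < lowerEnd (Ioo 0 δ) ρ t) ∧
        MonotoneOn (lowerEnd (Ioo 0 δ) ρ) (Ico 0 T) ∧
        (∀ t ∈ Ioo 0 T, ¬ SurjOn (ρ t) (Ioo 0 δ) (Ioo 0 δ)) := by
  have hc := sqrt_sub_one_pos hn
  obtain ⟨d, hd, hbd⟩ := hsol.exists_bounds hn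
  set c := √(n : ℝ) - 1
  have hSB : Ioo 0 d ⊆ radii B := fun x hx => (hbd x hx).1
  obtain ⟨u, hu⟩ := exists_straightening_coordinate hc hd
    ((contDiffOn_deriv (isOpen_radii B) hsol.smooth_phi).mono hSB) fun x hx => (hbd x hx).2.1
  -- `T` is so small that `1 + 2 lam t ≥ 1/2`, and that points from `(0, d/2)` stay in `(0, d)`.
  set T := min (1 / (4 * (|lam| + 1))) (d ^ 2 / (40 * c))
  have hTpos : 0 < T := by positivity
  have hsub : Ioo 0 (d / 2) ⊆ Ioo 0 d := Ioo_subset_Ioo_right (by linarith)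
  have hlow' : ∀ x ∈ Ioo 0 (d / 2), ∀ y, 0 < y → y ≤ x → y ∈ Ioo 0 (d / 2) :=
    fun x hx y hy hyx => ⟨hy, hyx.trans_lt hx.2⟩
  have hne : (Ioo 0 (d / 2)).Nonempty := nonempty_Ioo.2 (half_pos hd)
  have hhalf : ∀ t ∈ Ico 0 T, 1 / 2 ≤ 1 + 2 * lam * t := by
    intro t ht
    have h1 : t ≤ 1 / (4 * (|lam| + 1)) := ht.2.le.trans (min_le_left _ _)
    rw [le_div_iff₀ (by positivity)] at h1
    have h2 := mul_le_mul_of_nonneg_right (neg_abs_le lam) ht.1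
    nlinarith [ht.1]
  have hpos : ∀ t ∈ Ico 0 T, 0 < 1 + 2 * lam * t := fun t ht => by linarith [hhalf t ht]
  have h0T : (0 : ℝ) ∈ Ico 0 T := ⟨le_rfl, hTpos⟩
  have hs : ∀ t ∈ Ico 0 T, HasDerivWithinAt (timeChange lam) (1 / (1 + 2 * lam * t)) (Ico 0 T) t :=
    fun t ht => (hasDerivAt_timeChange (hpos t ht)).hasDerivWithinAt
  have hs_strict : StrictMonoOn (timeChange lam) (Ico 0 T) :=
    strictMonoOn_of_hasDerivWithinAt_pos (convex_Ico 0 T)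
      (fun t ht => (hs t ht).continuousWithinAt)
      (fun t ht => (hs t (interior_subset ht)).mono interior_subset)
      fun t ht => one_div_pos.2 (hpos t (interior_subset ht))
  have hs_nonneg : ∀ t ∈ Ico 0 T, 0 ≤ timeChange lam t := fun t ht => by
    simpa [timeChange_zero] using hs_strict.monotoneOn h0T ht ht.1
  have hs_pos : ∀ t ∈ Ioo 0 T, 0 < timeChange lam t := fun t ht => by
    simpa [timeChange_zero] using hs_strict h0T ⟨ht.1.le, ht.2⟩ ht.1
  have hs_le : ∀ t ∈ Ico 0 T, timeChange lam t ≤ d ^ 2 / (20 * c) := by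
    intro t ht
    have hm := monotoneOn_of_hasDerivWithinAt (convex_Ico 0 T)
      (fun τ hτ => ((hasDerivAt_id τ).const_mul 2).hasDerivWithinAt.sub (hs τ hτ)) (fun τ hτ => by
        have h1 := hpos τ hτ
        rw [sub_nonneg, div_le_iff₀ h1]
        linarith [hhalf τ hτ]) h0T ht ht.1
    simp only [id, Pi.sub_apply, timeChange_zero] at hm
    have h1 : t ≤ d ^ 2 / (40 * c) := ht.2.le.trans (min_le_right _ _)
    have h2 : d ^ 2 / (20 * c) = 2 * (d ^ 2 / (40 * c)) := by field_simp; norm_num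
    linarith
  have hα : ∀ t ∈ Ico 0 T, HasDerivWithinAt (fun _ => (1 : ℝ))
      (0 * (1 : ℝ) / (1 + 2 * lam * t)) (Ico 0 T) t := fun t _ => by
    simpa using hasDerivWithinAt_const t (Ico 0 T) (1 : ℝ)
  have hβ : ∀ t ∈ Ico 0 T, HasDerivWithinAt (timeChange lam)
      ((0 * timeChange lam t + 1) / (1 + 2 * lam * t)) (Ico 0 T) t := fun t ht => by
    simpa using hs t ht
  refine ⟨d / 2, half_pos hd, T, hTpos, hsub.trans hSB, hpos, ?_, fun ρ hρ => ?_⟩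
  · refine exists_isRadialFlow_of_coordinate hu (α := fun _ => 1) (β := timeChange lam) rfl
      (timeChange_zero lam) hα hβ hSB hsub fun t ht x hx => ?_
    -- `u - x² / (4 c)` is increasing, so the orbit cannot reach `3 d / 4` before time `T`.
    have hm := monotoneOn_of_hasDerivWithinAt (convex_Ioo 0 d) (fun y hy =>
      ((hu.hasDerivAt hy).sub (((hasDerivAt_id y).pow 2).div_const (4 * c))).hasDerivWithinAt)
      (fun y hy => by
        have h1 := hu.conj y hy
        have h2 := (hbd y hy).2
        have h3 := hu.deriv_pos y hy
        simp only [id]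
        rw [sub_nonneg, div_le_iff₀ (by positivity)]
        have h4 : deriv u y * (y * deriv φ y) = y := by linear_combination y * h1
        norm_num
        nlinarith)
    have hx2 : 3 * d / 4 ∈ Ioo 0 d := ⟨by linarith, by linarith⟩
    have h1 := hm (hsub hx) hx2 (by linarith [hx.2])
    simp only [id, Pi.sub_apply, Pi.pow_apply] at h1
    have h2 : x ^ 2 / (4 * c) + d ^ 2 / (20 * c) ≤ (3 * d / 4) ^ 2 / (4 * c) := by
      rw [div_add_div _ _ (by positivity) (by positivity), div_le_div_iff₀ (by positivity)
        (by positivity)]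
      have : x ^ 2 ≤ d ^ 2 / 4 := by nlinarith [hx.1, hx.2]
      have h5 : 0 < c ^ 2 := by positivity
      nlinarith [mul_le_mul_of_nonneg_left this h5.le, mul_pos h5 (pow_pos hd 2)]
    have h3 := hs_le t ht
    have h4 := hs_nonneg t ht
    have h0x := (hu.lt_iff_lt (mem_insert _ _) (Or.inr (hsub hx))).2 hx.1
    obtain ⟨y, hy, hyu⟩ := hu.exists_eq (x := 3 * d / 4) (z := 1 * u x + timeChange lam t)
      (Or.inr hx2) (by linarith) (by linarith)
    rcases hy with rfl | hy
    · linarith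
    · exact ⟨y, hy, hyu⟩
  have hρd : ∀ t ∈ Ico 0 T, ∀ x ∈ Ioo 0 (d / 2),
      HasDerivWithinAt (fun τ => ρ τ x ^ 2)
        (2 * (ρ t x * deriv φ (ρ t x)) / (1 + 2 * lam * t)) (Ico 0 T) t := by
    intro t ht x hx
    refine ((hρ.ode t ht x hx).pow 2).congr_deriv ?_
    norm_num
    ring
  -- As long as an orbit is in `(0, d)`, its square grows at a rate below `5 c / (1 + 2 lam t)`.
  have hmem : ∀ t ∈ Ico 0 T, ∀ x ∈ Ioo 0 (d / 2), ρ t x ∈ Ioo 0 d := by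
    intro t ht x hx
    have hsubI : Icc 0 t ⊆ Ico 0 T := fun τ hτ => ⟨hτ.1, hτ.2.trans_lt ht.2⟩
    have hbar : ∀ τ ∈ Ico 0 T, x ^ 2 + 5 * c * timeChange lam τ < d ^ 2 := by
      intro τ hτ
      have h1 : 5 * c * timeChange lam τ ≤ 5 * c * (d ^ 2 / (20 * c)) :=
        mul_le_mul_of_nonneg_left (hs_le τ hτ) (by positivity)
      have h2 : 5 * c * (d ^ 2 / (20 * c)) = d ^ 2 / 4 := by field_simp; norm_num
      nlinarith [hx.1, hx.2]
    have hbar' : ∀ τ ∈ Ico 0 T, HasDerivWithinAt (fun τ => x ^ 2 + 5 * c * timeChange lam τ)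
        (5 * c * (1 / (1 + 2 * lam * τ))) (Ico 0 T) τ :=
      fun τ hτ => ((hs τ hτ).const_mul (5 * c)).const_add (x ^ 2)
    have hnhds : ∀ τ ∈ Ico 0 t, Ico 0 T ∈ 𝓝[≥] τ := fun τ hτ =>
      mem_of_superset (Ico_mem_nhdsGE (hτ.2.trans ht.2)) (Ico_subset_Ico_left hτ.1)
    have key := image_le_of_deriv_right_lt_deriv_boundary' (a := 0) (b := t)
      (f := fun τ => ρ τ x ^ 2) (B := fun τ => x ^ 2 + 5 * c * timeChange lam τ)
      (fun τ hτ => ((hρd τ (hsubI hτ) x hx).continuousWithinAt).mono hsubI)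
      (fun τ hτ => (hρd τ (hsubI (Ico_subset_Icc_self hτ)) x hx).mono_of_mem_nhdsWithin
        (hnhds τ hτ))
      (by simp [hρ.init x hx, timeChange_zero])
      (fun τ hτ => ((hbar' τ (hsubI hτ)).continuousWithinAt).mono hsubI)
      (fun τ hτ => (hbar' τ (hsubI (Ico_subset_Icc_self hτ))).mono_of_mem_nhdsWithin (hnhds τ hτ))
      (fun τ hτ heq => by
        have hτT := hsubI (Ico_subset_Icc_self hτ)
        have h1 : 0 < ρ τ x := (hρ.mem τ hτT x hx).1
        have h2 : ρ τ x < d := lt_of_pow_lt_pow_left₀ 2 hd.le (by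
          rw [heq]; exact hbar τ hτT)
        have h3 := (hbd _ ⟨h1, h2⟩).2.2
        rw [mul_one_div]
        exact div_lt_div_of_pos_right (by linarith) (hpos τ hτT))
      (right_mem_Icc.2 ht.1)
    exact ⟨(hρ.mem t ht x hx).1, lt_of_pow_lt_pow_left₀ 2 hd.le (key.trans_lt (hbar t ht))⟩
  have hconj : ∀ t ∈ Ico 0 T, ∀ x ∈ Ioo 0 (d / 2),
      ρ t x ∈ Ioo 0 d ∧ u (ρ t x) = 1 * u x + timeChange lam t := fun t ht x hx =>
    ⟨hmem t ht x hx, coordinate_isRadialFlow hu (α := fun _ => 1) rfl (timeChange_zero lam) hα hβ hρ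
      (convex_Ico 0 T) h0T (fun _ _ => one_pos) hmem ht hx⟩
  refine ⟨fun t ht => hu.isRadialDiffeo_of_semiconj isOpen_Ioo hsub (hconj t ht) one_pos,
    isRadialRicciFlow_of_coordinate hsol.toIsGradientSoliton hu hSB isOpen_Ioo hsub hpos hρ
      (fun _ _ => one_pos) hα hconj, fun t ht x hx => ⟨?_, ?_⟩,
    fun t ht => hu.image_subset_of_semiconj hsub (hconj t ht) hlow' hne one_pos
      (by linarith [hs_nonneg t ht]),
    fun t ht => hu.sInf_pos_of_semiconj hsub (hconj t ⟨ht.1.le, ht.2⟩) hlow' hne one_pos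
      (by linarith [hs_pos t ht]),
    hu.monotoneOn_lowerEnd_of_semiconj hsub hlow' hne (fun _ _ => one_pos) hconj
      (fun t ht => by linarith [hs_nonneg t ht])
      (fun s hs' t ht hst => by
        have := hs_strict.monotoneOn hs' ht hst
        simp only
        linarith),
    fun t ht => hu.not_surjOn_of_semiconj hsub (hconj t ⟨ht.1.le, ht.2⟩) hlow' hne one_pos
      (by linarith [hs_pos t ht])⟩
  · have hm := monotoneOn_of_hasDerivWithinAt (convex_Ico 0 T)
      (fun τ hτ => (hρd τ hτ x hx).sub ((hs τ hτ).const_mul c)) (fun τ hτ => by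
        rw [mul_one_div, ← sub_div]
        exact div_nonneg (by linarith [(hbd _ (hmem τ hτ x hx)).2.1]) (hpos τ hτ).le) h0T ht ht.1
    simp only [Pi.sub_apply, hρ.init x hx, timeChange_zero] at hm
    linarith
  · have hm := monotoneOn_of_hasDerivWithinAt (convex_Ico 0 T)
      (fun τ hτ => ((hs τ hτ).const_mul (4 * c)).sub (hρd τ hτ x hx)) (fun τ hτ => by
        rw [mul_one_div, ← sub_div]
        exact div_nonneg (by linarith [(hbd _ (hmem τ hτ x hx)).2.2]) (hpos τ hτ).le) h0T ht ht.1
    simp only [Pi.sub_apply, hρ.init x hx, timeChange_zero] at hm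
    linarith

/-! ### Half-complete steady solitons -/

/-- A function that decreases at each of its zeros changes sign only once. -/
theorem exists_unique_zero_of_deriv_neg {f f' : ℝ → ℝ} (hf : ∀ x > 0, HasDerivAt f (f' x) x)
    (hneg : ∀ x > 0, f x = 0 → f' x < 0) (hpos : ∀ᶠ x in 𝓝[>] (0 : ℝ), 0 < f x)
    (hex : ∃ x > 0, f x ≤ 0) :
    ∃ c > 0, f c = 0 ∧ (∀ x ∈ Ioo 0 c, 0 < f x) ∧ ∀ x ∈ Ioi c, f x < 0 := by
  have hcont : ContinuousOn f (Ioi 0) := fun x hx => (hf x hx).continuousAt.continuousWithinAt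
  have hafter : ∀ c > 0, f c = 0 → ∀ x > c, f x < 0 := by
    intro c hc hfc
    have hle : ∀ y > c, f y ≤ 0 := fun y hy =>
      image_le_of_deriv_right_lt_deriv_boundary' (B := fun _ => 0) (B' := fun _ => 0)
        (hcont.mono fun x hx => hc.trans_le hx.1)
        (fun x hx => (hf x (hc.trans_le hx.1)).hasDerivWithinAt) hfc.le continuousOn_const
        (fun x _ => hasDerivWithinAt_const x _ 0) (fun x hx h0 => hneg x (hc.trans_le hx.1) h0)
        (right_mem_Icc.2 (le_of_lt hy))
    intro x hx
    refine (hle x hx).lt_of_ne fun h0 => ?_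
    -- A zero beyond `c` would be a local maximum.
    have hmax : IsLocalMax f x := by
      filter_upwards [Ioi_mem_nhds hx] with y hy
      rw [h0]
      exact hle y hy
    exact (hneg x (hc.trans hx) h0).ne (hmax.hasDerivAt_eq_zero (hf x (hc.trans hx)))
  have hzero : ∀ y > 0, f y ≤ 0 → ∃ c > 0, c ≤ y ∧ f c = 0 := by
    intro y hy hfy
    obtain ⟨x, hfx, hx⟩ := (hpos.and (Ioo_mem_nhdsGT hy)).exists
    obtain ⟨c, hc, hfc⟩ := intermediate_value_Icc' hx.2.le
      (hcont.mono fun z hz => hx.1.trans_le hz.1) ⟨hfy, hfx.le⟩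
    exact ⟨c, hx.1.trans_le hc.1, hc.2, hfc⟩
  obtain ⟨y, hy, hfy⟩ := hex
  obtain ⟨c, hc, -, hfc⟩ := hzero y hy hfy
  refine ⟨c, hc, hfc, fun x hx => ?_, hafter c hc hfc⟩
  by_contra hfx
  obtain ⟨z, hz, hzx, hfz⟩ := hzero x hx.1 (not_lt.1 hfx)
  exact (hafter z hz hfz c (hzx.trans_lt hx.2)).ne hfc

section HalfComplete

variable {n : ℕ} {ψ φ : ℝ → ℝ}

theorem mem_radii_top {x : ℝ} (hx : 0 < x) : x ∈ radii ⊤ := by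
  rw [radii_top]; exact hx

namespace IsHalfCompleteSoliton

variable (h : IsHalfCompleteSoliton n ψ φ)
include h

theorem recip_varW_pos {x : ℝ} (hx : 0 < x) : 0 < -deriv φ x + n * (deriv ψ x / ψ x) := by
  have hψ := h.psi_pos x (mem_radii_top hx)
  have hY := (h.quadrant x hx).2
  rw [varY, mul_div_assoc] at hY
  have h1 := pos_of_mul_pos_right hY (Real.sqrt_nonneg _)
  exact one_div_pos.1 ((div_pos_iff_of_pos_right hψ).1 h1)

theorem logDeriv_pos {x : ℝ} (hx : 0 < x) : 0 < deriv ψ x / ψ x := by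
  have h1 := one_div_pos.2 (h.recip_varW_pos hx)
  exact pos_of_mul_pos_right (h.quadrant x hx).1 (mul_nonneg (Real.sqrt_nonneg _) h1.le)

theorem antitoneOn_recip_varW :
    AntitoneOn (fun x => -deriv φ x + n * (deriv ψ x / ψ x)) (Ioi 0) := by
  have := monotoneOn_of_hasDerivWithinAt (convex_Ioi 0) (fun x hx =>
    (hasDerivAt_recip_varW h.toIsGradientSoliton (mem_radii_top hx)).neg.hasDerivWithinAt)
    (fun x hx => by
      rw [zero_sub, neg_neg]; positivity)
  exact fun x hx y hy hxy => neg_le_neg_iff.1 (this hx hy hxy)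

variable (hn : 2 ≤ n)
include hn

/-- The condition `X² + Y² < 1`, multiplied by `W⁻²`. -/
theorem disc_lt {x : ℝ} (hx : 0 < x) : n * (deriv ψ x / ψ x) ^ 2 + n * (n - 1) / ψ x ^ 2 <
    (-deriv φ x + n * (deriv ψ x / ψ x)) ^ 2 := by
  have hP := h.recip_varW_pos hx
  have hd := h.disc x hx
  have hn1 : (0 : ℝ) ≤ n * (n - 1) := by
    have : (2 : ℝ) ≤ n := by exact_mod_cast hn
    nlinarith
  simp only [varX, varY, varW, mul_pow, div_pow, Real.sq_sqrt n.cast_nonneg, Real.sq_sqrt hn1,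
    one_pow] at hd
  have h1 := mul_lt_mul_of_pos_right hd (pow_pos hP 2)
  rw [one_mul] at h1
  refine lt_of_eq_of_lt ?_ h1
  have := hP.ne'
  rw [← div_pow]
  generalize deriv ψ x / ψ x = q at *
  field_simp

theorem deriv_deriv_neg_of_zero {x : ℝ} (hx : 0 < x) (h0 : deriv φ x = 0) :
    deriv (deriv φ) x < 0 := by
  have hψ := h.psi_pos x (mem_radii_top hx)
  have h1 := h.radial_ode (mem_radii_top hx)
  have h2 := h.sphere_ode (mem_radii_top hx)
  have h3 := h.disc_lt hn hx
  have hn2 : (2 : ℝ) ≤ n := by exact_mod_cast hn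
  rw [h0, neg_zero, zero_add, div_pow] at h3
  have h4 : (n : ℝ) * (n - 1) < n * (n - 1) * deriv ψ x ^ 2 := by
    have h5 := mul_lt_mul_of_pos_right h3 (pow_pos hψ 2)
    have h6 : (n * (deriv ψ x ^ 2 / ψ x ^ 2) + n * (n - 1) / ψ x ^ 2) * ψ x ^ 2 =
      n * deriv ψ x ^ 2 + n * (n - 1) := by field_simp
    have h7 : (n * (deriv ψ x / ψ x)) ^ 2 * ψ x ^ 2 = n ^ 2 * deriv ψ x ^ 2 := by field_simp
    rw [h6, h7] at h5
    linarith
  have h5 : n * (ψ x * deriv (deriv ψ) x) < 0 := by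
    rw [h2, h0]
    linarith
  have h6 : n * (deriv (deriv ψ) x / ψ x) = n * (ψ x * deriv (deriv ψ) x) / ψ x ^ 2 := by
    field_simp
  rw [add_zero, h6] at h1
  rw [h1]
  exact div_neg_of_neg_of_pos h5 (pow_pos hψ 2)

/-- The quantity `(1 - X² - Y²) / W²` is constant along a steady soliton. -/
theorem exists_conserved : ∃ C > 0, ∀ x > 0,
    (-deriv φ x + n * (deriv ψ x / ψ x)) ^ 2 =
      C + (n * (deriv ψ x / ψ x) ^ 2 + n * (n - 1) / ψ x ^ 2) := by
  have hO := isOpen_radii ⊤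
  have hd : ∀ x ∈ Ioi (0 : ℝ), HasDerivWithinAt (fun x => (-deriv φ x + n * (deriv ψ x / ψ x)) ^ 2 -
      (n * (deriv ψ x / ψ x) ^ 2 + n * (n - 1) / ψ x ^ 2)) 0 (Ioi 0) x := by
    intro x hx
    have hxB := mem_radii_top hx
    have hne := (h.psi_pos x hxB).ne'
    have h1 := hasDerivAt_recip_varW h.toIsGradientSoliton hxB
    have h2 := hasDerivAt_of_contDiffOn hO (contDiffOn_deriv hO h.smooth_psi) hxB
    have h3 := hasDerivAt_of_contDiffOn hO h.smooth_psi hxB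
    have h4 := ((h2.div h3 hne).pow 2).const_mul (n : ℝ)
    have h5 := (hasDerivAt_const x ((n : ℝ) * (n - 1))).div (h3.pow 2) (pow_ne_zero 2 hne)
    refine ((h1.pow 2).sub (h4.add h5)).hasDerivWithinAt.congr_deriv ?_
    have h6 := h.sphere_ode hxB
    have h7 : deriv (deriv ψ) x = ((n - 1) - (n - 1) * deriv ψ x ^ 2 +
        ψ x * deriv ψ x * deriv φ x) / ψ x := by
      rw [eq_div_iff hne]; linarith
    simp only [Pi.div_apply, Pi.pow_apply, h7, Nat.add_one_sub_one, pow_one]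
    field_simp
    ring
  have hpos : ∀ x > 0, 0 < (-deriv φ x + n * (deriv ψ x / ψ x)) ^ 2 -
      (n * (deriv ψ x / ψ x) ^ 2 + n * (n - 1) / ψ x ^ 2) := fun x hx =>
    sub_pos.2 (h.disc_lt hn hx)
  refine ⟨_, hpos 1 one_pos, fun x hx => ?_⟩
  have := (convex_Ioi (0 : ℝ)).norm_image_sub_le_of_norm_hasDerivWithin_le (C := 0) hd (by simp)
    (mem_Ioi.2 (one_pos (α := ℝ))) (show x ∈ Ioi 0 from hx)
  rw [zero_mul, norm_le_zero_iff, sub_eq_zero] at this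
  linarith

/-- If `ω` stayed positive, then `1 / W ≤ n ψ' / ψ`, and `(1 / W)' = -n (ψ' / ψ)²` would be bounded
above by a negative constant, as `1 / W² ≥ C`. But `1 / W` is positive. -/
theorem exists_deriv_nonpos : ∃ x > 0, deriv φ x ≤ 0 := by
  by_contra! hcon
  obtain ⟨C, hC, hcons⟩ := h.exists_conserved hn
  have hn0 : (0 : ℝ) < n := by exact_mod_cast (by omega : 0 < n)
  have hn1 : (1 : ℝ) ≤ n := by exact_mod_cast (by omega : 1 ≤ n)
  have hmono := monotoneOn_of_hasDerivWithinAt (convex_Ioi (0 : ℝ)) (fun x hx =>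
    ((hasDerivAt_recip_varW h.toIsGradientSoliton (mem_radii_top hx)).neg.sub
      ((hasDerivAt_id x).const_mul (C / n))).hasDerivWithinAt) (fun x hx => by
    have h1 := hcon x hx
    have h2 := hcons x hx
    have h3 := h.recip_varW_pos hx
    have h4 : (0 : ℝ) ≤ n * (n - 1) / ψ x ^ 2 :=
      div_nonneg (mul_nonneg hn0.le (by linarith)) (sq_nonneg _)
    have h5 : C ≤ (n * (deriv ψ x / ψ x)) ^ 2 := by
      have h6 : (-deriv φ x + n * (deriv ψ x / ψ x)) ^ 2 ≤ (n * (deriv ψ x / ψ x)) ^ 2 :=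
        pow_le_pow_left₀ h3.le (by linarith) 2
      have h7 : 0 ≤ n * (deriv ψ x / ψ x) ^ 2 := by positivity
      linarith
    have h6 : C / n ≤ n * (deriv ψ x / ψ x) ^ 2 := by
      rw [div_le_iff₀ hn0]
      linarith
    linarith)
  have hP1 := h.recip_varW_pos one_pos
  set P := fun x => -deriv φ x + n * (deriv ψ x / ψ x) with hPdef
  have hx : (0 : ℝ) < 1 + P 1 * n / C := by positivity
  have h1 := hmono (mem_Ioi.2 (one_pos (α := ℝ))) hx (by
    have : 0 < P 1 * n / C := by positivity
    linarith)
  have h2 := h.recip_varW_pos hx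
  change -P 1 - C / n * 1 ≤ -P (1 + P 1 * n / C) - C / n * (1 + P 1 * n / C) at h1
  have h3 : C / n * (1 + P 1 * n / C) = C / n + P 1 := by field_simp
  change 0 < P (1 + P 1 * n / C) at h2
  linarith

theorem exists_xcrit : ∃ c > 0, deriv φ c = 0 ∧ (∀ x ∈ Ioo 0 c, 0 < deriv φ x) ∧
    ∀ x ∈ Ioi c, deriv φ x < 0 := by
  have hO := isOpen_radii ⊤
  refine exists_unique_zero_of_deriv_neg (fun x hx => hasDerivAt_of_contDiffOn hO
    (contDiffOn_deriv hO h.smooth_phi) (mem_radii_top hx))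
    (fun x hx h0 => h.deriv_deriv_neg_of_zero hn hx h0) ?_ (h.exists_deriv_nonpos hn)
  filter_upwards [h.tendsto_mul_deriv.eventually (Ioi_mem_nhds (sqrt_sub_one_pos hn)),
    self_mem_nhdsWithin] with x hx hx0
  exact pos_of_mul_pos_right hx (le_of_lt hx0)

/-- In the coordinate `u` linearising `ω` at its zero `c`, the singularity is at a finite point and
the end `x = +∞` is at infinity: `1 / ω` is bounded near `0`, and `ω` is bounded below near `+∞`. -/
theorem exists_coordinate {c : ℝ} (hc : 0 < c) (h0 : deriv φ c = 0)
    (hleft : ∀ x ∈ Ioo 0 c, 0 < deriv φ x) (hright : ∀ x ∈ Ioi c, deriv φ x < 0) :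
    ∃ u, IsAffineCoordinate (Ioi 0) (deriv φ) u (deriv (deriv φ) c) 0 ∧ u c = 0 ∧
      ∀ z, ∃ x > 0, z < u x := by
  have hk := h.deriv_deriv_neg_of_zero hn hc h0
  set k := deriv (deriv φ) c
  have hsmooth : ContDiffOn ℝ ∞ (deriv φ) (Ioi 0) := by
    have := contDiffOn_deriv (isOpen_radii ⊤) h.smooth_phi
    rwa [radii_top] at this
  obtain ⟨F, hF, hFc, hF', hconj⟩ := exists_linearizing_coordinate isOpen_Ioi ordConnected_Ioi
    (show c ∈ Ioi 0 from hc) hsmooth h0 hk (fun x hx hxc => hleft x ⟨hx, hxc⟩)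
    (fun x _ hxc => hright x hxc)
  have hFmono : StrictMonoOn F (Ioi 0) := strictMonoOn_of_deriv_pos (convex_Ioi 0) hF.continuousOn
    (by rw [interior_Ioi]; exact hF')
  have hbdd : BddBelow (F '' Ioi 0) := by
    obtain ⟨d', hd', hb⟩ := h.exists_bounds hn
    have hcn := sqrt_sub_one_pos hn
    set e := √(n : ℝ) - 1
    set d := min d' c
    have hd : 0 < d := lt_min hd' hc
    have hneg : ∀ x ∈ Ioo 0 d, F x < 0 := fun x hx => by
      rw [← hFc]; exact hFmono hx.1 hc (hx.2.trans_le (min_le_right _ _))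
    obtain ⟨M, hM⟩ := bddBelow_image_of_abs_deriv_le (f := fun x => Real.log (F x))
      (K := -k * (2 * d / e)) hd (fun x hx =>
        (hasDerivAt_of_contDiffOn isOpen_Ioi hF hx.1).log (hneg x hx).ne) (fun x hx => by
        have h1 := (hb x ⟨hx.1, hx.2.trans_le (min_le_left _ _)⟩).2.1
        have h2 : 0 < deriv φ x := hleft x ⟨hx.1, hx.2.trans_le (min_le_right _ _)⟩
        have h3 : deriv F x / F x = k / deriv φ x := by
          rw [div_eq_div_iff (hneg x hx).ne h2.ne']
          exact hconj x hx.1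
        rw [h3, abs_div, abs_of_neg hk, abs_of_pos h2, div_eq_mul_one_div]
        refine mul_le_mul_of_nonneg_left ?_ (by linarith)
        rw [div_le_div_iff₀ h2 hcn]
        nlinarith [hx.2])
    have hlow : ∀ x ∈ Ioo 0 d, -Real.exp M ≤ F x := by
      intro x hx
      have h1 := (abs_le.1 (hM x hx)).2
      rw [← Real.log_neg_eq_log, Real.log_le_iff_le_exp (by linarith [hneg x hx])] at h1
      linarith
    refine ⟨-Real.exp M, ?_⟩
    rintro - ⟨x, hx, rfl⟩
    by_cases hxd : x < d
    · exact hlow x ⟨hx, hxd⟩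
    · exact (hlow (d / 2) ⟨by linarith, by linarith⟩).trans
        (hFmono.monotoneOn (show (0 : ℝ) < d / 2 by linarith) hx (by linarith))
  obtain ⟨u, huF, hu⟩ := IsAffineCoordinate.of_bddBelow (V := deriv φ) (κ := k) (μ := 0)
    isOpen_Ioi ordConnected_Ioi (fun x hx => hx) (fun x _ y hy _ => hy) nonempty_Ioi hF hF' hbdd
    (fun x hx => by rw [add_zero]; exact hconj x hx)
  have huc : u c = 0 := by rw [huF c hc, hFc]
  refine ⟨u, hu, huc, fun z => ?_⟩
  have hx1 : c < c + 1 := by linarith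
  have hx1' : 0 < c + 1 := by linarith
  have hM := h.recip_varW_pos hx1'
  set M := -deriv φ (c + 1) + n * (deriv ψ (c + 1) / ψ (c + 1))
  have hU : 0 < u (c + 1) := by
    rw [← huc]; exact hu.strictMono (Or.inr hc) (Or.inr hx1') hx1
  -- Beyond `c + 1` the slope of `u` is at least `-k u(c + 1) / M`.
  have hslope : 0 < -k * u (c + 1) / M := div_pos (mul_pos (by linarith) hU) hM
  have hmono := monotoneOn_of_hasDerivWithinAt (convex_Ici (c + 1)) (fun x hx =>
    ((hu.hasDerivAt (show x ∈ Ioi 0 from hx1'.trans_le hx)).sub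
      ((hasDerivAt_id x).const_mul (-k * u (c + 1) / M))).hasDerivWithinAt) (fun x hx => by
    have hx0 : 0 < x := hx1'.trans_le hx
    have h1 := hu.conj x hx0
    have h2 := hu.deriv_pos x hx0
    have h3 : u (c + 1) ≤ u x := hu.strictMono.monotoneOn (Or.inr hx1') (Or.inr hx0) hx
    have h4 : -deriv φ x + n * (deriv ψ x / ψ x) ≤ M :=
      h.antitoneOn_recip_varW hx1' hx0 hx
    have h5 : 0 < n * (deriv ψ x / ψ x) :=
      mul_pos (by exact_mod_cast (by omega : 0 < n)) (h.logDeriv_pos hx0)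
    rw [mul_one, sub_nonneg, div_le_iff₀ hM]
    have h6 : -deriv φ x ≤ M := by linarith
    have h7 := mul_le_mul_of_nonneg_left h6 h2.le
    have h8 := mul_le_mul_of_nonneg_left h3 (by linarith : 0 ≤ -k)
    linarith)
  set s := -k * u (c + 1) / M
  set x := c + 1 + (|z| + 1) / s
  have hxge : c + 1 ≤ x := by
    have : 0 < (|z| + 1) / s := by positivity
    linarith
  refine ⟨x, hx1'.trans_le hxge, ?_⟩
  have h1 := hmono (self_mem_Ici) hxge hxge
  simp only [Pi.sub_apply, id] at h1
  have h2 : s * x = s * (c + 1) + (|z| + 1) := by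
    simp only [x]; field_simp
  linarith [le_abs_self z]

end IsHalfCompleteSoliton

theorem half_complete_soliton_flow (hn : 2 ≤ n) (h : IsHalfCompleteSoliton n ψ φ) :
    ∃ xcrit > 0,
      (∀ x > 0, deriv φ x = 0 ↔ x = xcrit) ∧
      (∀ x ∈ Ioo 0 xcrit, 0 < deriv φ x) ∧
      (∀ x ∈ Ioi xcrit, deriv φ x < 0) ∧
      (∃ ρ, IsRadialFlow 0 ⊤ φ (Ici 0) (Ioi 0) ρ) ∧
      ∀ ρ, IsRadialFlow 0 ⊤ φ (Ici 0) (Ioi 0) ρ →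
        (∀ t ∈ Ici 0, IsRadialDiffeo (Ioi 0) (ρ t)) ∧
        IsRadialRicciFlow n (Ici 0) (Ioi 0) (evolvingChi 0 ρ) (evolvingPsi 0 ψ ρ) ∧
        (∀ t ∈ Ici 0, ρ t '' Ioi 0 = Ioi (lowerEnd (Ioi 0) ρ t)) ∧
        (∀ t ∈ Ioi 0, 0 < lowerEnd (Ioi 0) ρ t) ∧
        MonotoneOn (lowerEnd (Ioi 0) ρ) (Ici 0) ∧
        (∀ t ∈ Ioi 0, ¬ SurjOn (ρ t) (Ioi 0) (Ioi 0)) ∧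
        (∀ x ∈ Ioi 0, Tendsto (fun t => ρ t x) atTop (𝓝 xcrit)) ∧
        Tendsto (lowerEnd (Ioi 0) ρ) atTop (𝓝 xcrit) := by
  obtain ⟨c, hc, h0, hleft, hright⟩ := h.exists_xcrit hn
  obtain ⟨u, hu, huc, hutop⟩ := h.exists_coordinate hn hc h0 hleft hright
  have hk := h.deriv_deriv_neg_of_zero hn hc h0
  set k := deriv (deriv φ) c
  have hSB : Ioi (0 : ℝ) ⊆ radii ⊤ := by rw [radii_top]
  have hu0 : u 0 < 0 := by
    have := hu.strictMono (mem_insert _ _) (Or.inr hc) hc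
    rwa [huc] at this
  have hα0 : Real.exp (k * 0) = 1 := by simp
  have hαpos : ∀ t ∈ Ici (0 : ℝ), 0 < Real.exp (k * t) := fun t _ => Real.exp_pos _
  have hα1 : ∀ t ∈ Ici (0 : ℝ), Real.exp (k * t) ≤ 1 := fun t ht =>
    Real.exp_le_one_iff.2 (mul_nonpos_of_nonpos_of_nonneg hk.le ht)
  have hα1' : ∀ t ∈ Ioi (0 : ℝ), Real.exp (k * t) < 1 := fun t ht =>
    Real.exp_lt_one_iff.2 (mul_neg_of_neg_of_pos hk ht)
  have hα : ∀ t ∈ Ici (0 : ℝ), HasDerivWithinAt (fun t => Real.exp (k * t))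
      (k * Real.exp (k * t) / (1 + 2 * 0 * t)) (Ici 0) t := fun t _ => by
    have := (((hasDerivAt_id t).const_mul k).exp).hasDerivWithinAt (s := Ici 0)
    refine this.congr_deriv ?_
    simp [mul_comm]
  have hβ : ∀ t ∈ Ici (0 : ℝ), HasDerivWithinAt (fun _ => (0 : ℝ))
      ((k * 0 + 0) / (1 + 2 * 0 * t)) (Ici 0) t := fun t _ => by
    simpa using hasDerivWithinAt_const t (Ici (0 : ℝ)) (0 : ℝ)
  have hgt : ∀ t ∈ Ici (0 : ℝ), u 0 ≤ Real.exp (k * t) * u 0 + 0 := fun t ht => by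
    nlinarith [hα1 t ht]
  have hgt' : ∀ t ∈ Ioi (0 : ℝ), u 0 < Real.exp (k * t) * u 0 + 0 := fun t ht => by
    nlinarith [hα1' t ht]
  refine ⟨c, hc, fun x hx => ⟨fun hx0 => ?_, fun hxc => hxc ▸ h0⟩, hleft, hright, ?_,
    fun ρ hρ => ?_⟩
  · rcases lt_trichotomy x c with hlt | heq | hgt
    · exact absurd hx0 (hleft x ⟨hx, hlt⟩).ne'
    · exact heq
    · exact absurd hx0 (hright x hgt).ne
  · refine exists_isRadialFlow_of_coordinate hu (α := fun t => Real.exp (k * t)) (β := fun _ => 0)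
      hα0 rfl hα hβ hSB subset_rfl fun t ht x hx => ?_
    -- The point `exp (k t) u(x)` lies between `u(x)` and `u(c) = 0`.
    have h1 := hα1 t ht
    have h2 := hαpos t ht
    have h3 := (hu.lt_iff_lt (mem_insert _ _) (Or.inr hx)).2 hx
    have hlow : u 0 < Real.exp (k * t) * u x + 0 := by
      rcases le_total 0 (u x) with h4 | h4 <;> nlinarith
    obtain ⟨y, hy, hyz⟩ : ∃ y ∈ insert 0 (Ioi 0), u y = Real.exp (k * t) * u x + 0 := by
      rcases le_total 0 (u x) with h4 | h4
      · exact hu.exists_eq (Or.inr hx) hlow.le (by nlinarith)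
      · exact hu.exists_eq (Or.inr hc) hlow.le (by rw [huc]; nlinarith)
    refine ⟨y, ?_, hyz⟩
    rw [mem_Ioi, ← hu.lt_iff_lt (mem_insert _ _) hy, hyz]
    exact hlow
  have hmem : ∀ t ∈ Ici (0 : ℝ), ∀ x ∈ Ioi (0 : ℝ), ρ t x ∈ Ioi 0 := fun t ht x hx =>
    (hρ.mem t ht x hx).1
  have hconj : ∀ t ∈ Ici (0 : ℝ), ∀ x ∈ Ioi (0 : ℝ),
      ρ t x ∈ Ioi 0 ∧ u (ρ t x) = Real.exp (k * t) * u x + 0 := fun t ht x hx =>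
    ⟨hmem t ht x hx, coordinate_isRadialFlow hu (α := fun t => Real.exp (k * t)) (β := fun _ => 0)
      hα0 rfl hα hβ hρ (convex_Ici 0) self_mem_Ici hαpos hmem ht hx⟩
  have hlow : ∀ x ∈ Ioi (0 : ℝ), ∀ y, 0 < y → y ≤ x → y ∈ Ioi (0 : ℝ) := fun _ _ y hy _ => hy
  have hne : (Ioi (0 : ℝ)).Nonempty := nonempty_Ioi
  have hend : ∀ t ∈ Ici (0 : ℝ), lowerEnd (Ioi 0) ρ t ∈ insert 0 (Ioi 0) ∧
      u (lowerEnd (Ioi 0) ρ t) = Real.exp (k * t) * u 0 + 0 := fun t ht =>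
    hu.sInf_image_of_semiconj subset_rfl (hconj t ht) hlow hne (hαpos t ht) (hgt t ht)
  have hendpos : ∀ t ∈ Ioi (0 : ℝ), 0 < lowerEnd (Ioi 0) ρ t := fun t ht =>
    hu.sInf_pos_of_semiconj subset_rfl (hconj t (Ioi_subset_Ici_self ht)) hlow hne (Real.exp_pos _) (hgt' t ht)
  -- Convergence to `c` in `(0, ∞)` is convergence to `0` in the coordinate `u`.
  have hlim : ∀ (f : ℝ → ℝ) (a : ℝ), (∀ t > 0, 0 < f t ∧ u (f t) = Real.exp (k * t) * a + 0) →
      Tendsto f atTop (𝓝 c) := by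
    intro f a hf
    have h1 : Tendsto (fun t => Real.exp (k * t) * a + 0) atTop (𝓝 (u c)) := by
      rw [huc]
      simpa using (Real.tendsto_exp_atBot.comp
        (tendsto_id.const_mul_atTop_of_neg hk)).mul_const a
    have h2 := (hu.hasDerivAt_invFunOn hc).continuousAt.tendsto.comp h1
    rw [hu.injOn.leftInvOn_invFunOn hc] at h2
    refine h2.congr' ?_
    filter_upwards [eventually_gt_atTop 0] with t ht
    rw [Function.comp, ← (hf t ht).2]
    exact hu.injOn.leftInvOn_invFunOn (hf t ht).1
  refine ⟨fun t ht => hu.isRadialDiffeo_of_semiconj isOpen_Ioi subset_rfl (hconj t ht)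
      (hαpos t ht),
    isRadialRicciFlow_of_coordinate h.toIsGradientSoliton hu hSB isOpen_Ioi subset_rfl
      (fun t _ => by simp) hρ hαpos hα hconj,
    fun t ht => Subset.antisymm (hu.image_subset_of_semiconj subset_rfl (hconj t ht) hlow hne
      (hαpos t ht) (hgt t ht)) fun y hy => ?_,
    hendpos,
    hu.monotoneOn_lowerEnd_of_semiconj subset_rfl hlow hne hαpos hconj hgt
      (fun s _ t _ hst => ?_),
    fun t ht => hu.not_surjOn_of_semiconj subset_rfl (hconj t (Ioi_subset_Ici_self ht)) hlow hne
      (Real.exp_pos _) (hgt' t ht),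
    fun x hx => hlim (fun t => ρ t x) (u x) fun t ht => hconj t (Ioi_subset_Ici_self ht) x hx,
    hlim _ (u 0) fun t ht => ⟨hendpos t ht, (hend t (Ioi_subset_Ici_self ht)).2⟩⟩
  · obtain ⟨x, hx, hxy⟩ := hutop (u y / Real.exp (k * t))
    have hy0 : 0 < y := by
      rcases (hend t ht).1 with hm | hm
      · rw [← hm]; exact hy
      · exact lt_trans hm hy
    refine hu.mem_image_of_semiconj subset_rfl (hconj t ht) hlow (hαpos t ht) (hend t ht).1
      (hend t ht).2 hx hy ?_
    rw [← hu.strictMono.le_iff_le (Or.inr hy0) (Or.inr (hconj t ht x hx).1), (hconj t ht x hx).2]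
    rw [div_lt_iff₀ (Real.exp_pos _)] at hxy
    linarith
  · have h1 : Real.exp (k * t) ≤ Real.exp (k * s) :=
      Real.exp_le_exp.2 (mul_le_mul_of_nonpos_left hst hk.le)
    simp only
    nlinarith

end HalfComplete

end RadialSoliton

theorem mainTheorem4 (n : ℕ) (hn : 2 ≤ n) :
    -- all singular solitons, near the singularity and for small times
    (∀ (lam : ℝ) (B : EReal) (ψ φ : ℝ → ℝ), RadialSoliton.IsSingularSoliton n lam B ψ φ →
      ∃ δ > 0, ∃ T > 0, Ioo 0 δ ⊆ RadialSoliton.radii B ∧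
        (∀ t ∈ Ico 0 T, 0 < 1 + 2 * lam * t) ∧
        (∃ ρ, RadialSoliton.IsRadialFlow lam B φ (Ico 0 T) (Ioo 0 δ) ρ) ∧
        ∀ ρ, RadialSoliton.IsRadialFlow lam B φ (Ico 0 T) (Ioo 0 δ) ρ →
          (∀ t ∈ Ico 0 T, RadialSoliton.IsRadialDiffeo (Ioo 0 δ) (ρ t)) ∧
          RadialSoliton.IsRadialRicciFlow n (Ico 0 T) (Ioo 0 δ)
            (RadialSoliton.evolvingChi lam ρ) (RadialSoliton.evolvingPsi lam ψ ρ) ∧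
          (lam = 0 → ∀ t ∈ Ico 0 T, ∀ x ∈ Ioo 0 δ,
            x ^ 2 + (√(n : ℝ) - 1) * t ≤ ρ t x ^ 2 ∧
            ρ t x ^ 2 ≤ x ^ 2 + 4 * (√(n : ℝ) - 1) * t) ∧
          (lam ≠ 0 → ∀ t ∈ Ico 0 T, ∀ x ∈ Ioo 0 δ,
            x ^ 2 + (√(n : ℝ) - 1) / (2 * lam) * Real.log (1 + 2 * lam * t) ≤ ρ t x ^ 2 ∧
            ρ t x ^ 2 ≤ x ^ 2 + 2 * ((√(n : ℝ) - 1) / lam) * Real.log (1 + 2 * lam * t)) ∧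
          (∀ t ∈ Ico 0 T, ρ t '' Ioo 0 δ ⊆ Ioi (RadialSoliton.lowerEnd (Ioo 0 δ) ρ t)) ∧
          (∀ t ∈ Ioo 0 T, 0 < RadialSoliton.lowerEnd (Ioo 0 δ) ρ t) ∧
          MonotoneOn (RadialSoliton.lowerEnd (Ioo 0 δ) ρ) (Ico 0 T) ∧
          (∀ t ∈ Ioo 0 T, ¬ SurjOn (ρ t) (Ioo 0 δ) (Ioo 0 δ))) ∧
    -- half-complete steady solitons, globally
    (∀ ψ φ : ℝ → ℝ, RadialSoliton.IsHalfCompleteSoliton n ψ φ →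
      ∃ xcrit > 0,
        (∀ x > 0, deriv φ x = 0 ↔ x = xcrit) ∧
        (∀ x ∈ Ioo 0 xcrit, 0 < deriv φ x) ∧
        (∀ x ∈ Ioi xcrit, deriv φ x < 0) ∧
        (∃ ρ, RadialSoliton.IsRadialFlow 0 ⊤ φ (Ici 0) (Ioi 0) ρ) ∧
        ∀ ρ, RadialSoliton.IsRadialFlow 0 ⊤ φ (Ici 0) (Ioi 0) ρ →
          (∀ t ∈ Ici 0, RadialSoliton.IsRadialDiffeo (Ioi 0) (ρ t)) ∧
          RadialSoliton.IsRadialRicciFlow n (Ici 0) (Ioi 0)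
            (RadialSoliton.evolvingChi 0 ρ) (RadialSoliton.evolvingPsi 0 ψ ρ) ∧
          (∀ t ∈ Ici 0, ρ t '' Ioi 0 = Ioi (RadialSoliton.lowerEnd (Ioi 0) ρ t)) ∧
          (∀ t ∈ Ioi 0, 0 < RadialSoliton.lowerEnd (Ioi 0) ρ t) ∧
          MonotoneOn (RadialSoliton.lowerEnd (Ioi 0) ρ) (Ici 0) ∧
          (∀ t ∈ Ioi 0, ¬ SurjOn (ρ t) (Ioi 0) (Ioi 0)) ∧
          (∀ x ∈ Ioi 0, Tendsto (fun t => ρ t x) atTop (𝓝 xcrit)) ∧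
          Tendsto (RadialSoliton.lowerEnd (Ioi 0) ρ) atTop (𝓝 xcrit)) := by
  refine ⟨fun lam B ψ φ hsol => ?_, fun ψ φ h => RadialSoliton.half_complete_soliton_flow hn h⟩
  obtain ⟨δ, hδ, T, hT, hsub, hpos, hex, hall⟩ := RadialSoliton.singular_soliton_local_flow hn hsol
  refine ⟨δ, hδ, T, hT, hsub, hpos, hex, fun ρ hρ => ?_⟩
  obtain ⟨h1, h2, h3, h4⟩ := hall ρ hρ
  refine ⟨h1, h2, fun hlam t ht x hx => ?_, fun hlam t ht x hx => ?_, h4⟩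
  · simpa [RadialSoliton.timeChange, hlam] using h3 t ht x hx
  · have h5 := h3 t ht x hx
    rw [RadialSoliton.timeChange, if_neg hlam] at h5
    refine ⟨le_of_eq_of_le ?_ h5.1, h5.2.trans_eq ?_⟩ <;> field_simp
    ring
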